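/- Let $k$ be a field, let $n\ge 0$, and let $X=\{x_1<x_2<\cdots<x_n\}$ be a finite ordered set. Let $\Re_0$ be a set of binomial relations of skew-polynomial type in the free associative algebra $k\langle X\rangle$; that is, $$\Re_0=\{\,x_jx_i-c_{ij}\,x_{i'}x_{j'} \mid 1\le i<j\le n\,\}$$ consists of exactly one relation for each pair $i<j$ (where $c_{ij}\in k$ and the indices $i',j'$ depend on $(i,j)$), such that 1. each monomial $xy$ with $x,y\in X$, $x\neq y$, occurs in exactly one relation of $\Re_0$, and no monomial $xx$ occurs in a relation of $\Re_0$; 2. $c_{ij}\ne 0$ for all $i<j$; 3. $j>i'$ and $i'<j'$ for all $i<j$. (Thus $A_0=k\langle X\rangle/(\Re_0)$ is an algebra with binomial relations of skew-polynomial type.) Let $V$ be a $k$-vector space with basis $x_1,\dots,x_n$, and let $R=R(\Re_0)$ be the linear automorphism of $V\otimes V$ given by $$R(x_j\otimes x_i)=c_{ij}\,x_{i'}\otimes x_{j'},\qquad R(x_{i'}\otimes x_{j'})=c_{ij}^{-1}\,x_j\otimes x_i\quad(1\le i<j\le n),\qquad R(x_i\otimes x_i)=x_i\otimes x_i\quad(1\le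 i\le n).$$ Then $R$ is a solution of the (classical) Yang–Baxter equation $$(R\otimes \mathrm{id}_V)(\mathrm{id}_V\otimes R)(R\otimes \mathrm{id}_V)=(\mathrm{id}_V\otimes R)(R\otimes \mathrm{id}_V)(\mathrm{id}_V\otimes R)$$ in the automorphism group of $V\otimes V\otimes V$ if and only if $\Re_0$ is a Gröbner basis of the two-sided ideal $(\Re_0)$ of $k\langle X\rangle$ with respect to the degree-lexicographic order on words in $X$ induced by $x_1<\cdots<x_n$ (that is, the highest word of every nonzero element of $(\Re_0)$ contains the highest word of some element of $\Re_0$ as a contiguous subword). -/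

import Mathlib

open scoped TensorProduct

/-! ### The Yang-Baxter equation -/

section YangBaxter

variable {k V : Type*} [Field k] [AddCommGroup V] [Module k V]

/-- `R ⊗ id_V`, as an automorphism of `V ⊗ V ⊗ V = (V ⊗ V) ⊗ V`. -/
noncomputable def actLeft (R : (V ⊗[k] V) ≃ₗ[k] (V ⊗[k] V)) :
    ((V ⊗[k] V) ⊗[k] V) ≃ₗ[k] ((V ⊗[k] V) ⊗[k] V) :=
  TensorProduct.congr R (LinearEquiv.refl k V)

/-- `id_V ⊗ R`, as an automorphism of `V ⊗ V ⊗ V = (V ⊗ V) ⊗ V`. -/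
noncomputable def actRight (R : (V ⊗[k] V) ≃ₗ[k] (V ⊗[k] V)) :
    ((V ⊗[k] V) ⊗[k] V) ≃ₗ[k] ((V ⊗[k] V) ⊗[k] V) :=
  (TensorProduct.assoc k V V V).trans
    ((TensorProduct.congr (LinearEquiv.refl k V) R).trans (TensorProduct.assoc k V V V).symm)

/-- `R` is a solution of the (classical) Yang-Baxter equation:
`(R ⊗ id)(id ⊗ R)(R ⊗ id) = (id ⊗ R)(R ⊗ id)(id ⊗ R)` in the automorphism group of
`V ⊗ V ⊗ V`. -/
def IsYangBaxterSolution (R : (V ⊗[k] V) ≃ₗ[k] (V ⊗[k] V)) : Prop :=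
  actLeft R * actRight R * actLeft R = actRight R * actLeft R * actRight R

end YangBaxter

/-! ### Groebner bases in the free associative algebra -/

section Groebner

variable {k X : Type*} [Field k]

/-- The monomials (words in `X`) that occur in `f` with a nonzero coefficient. -/
def wordSupport (f : FreeAlgebra k X) : Set (List X) :=
  {w | (FreeAlgebra.equivMonoidAlgebraFreeMonoid f).coeff (FreeMonoid.ofList w) ≠ 0}

/-- `w` is the highest monomial of `f` with respect to the degree-lexicographic order on words
induced by the order of `X`. -/
def IsLeadingWord [LinearOrder X] (f : FreeAlgebra k X) (w : List X) : Prop :=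
  w ∈ wordSupport f ∧ ∀ v ∈ wordSupport f, v ≠ w → List.Shortlex (· < ·) v w

/-- `F` is a Groebner basis of the two-sided ideal `I` with respect to the degree-lexicographic
order: `F ⊆ I`, and the highest monomial of every nonzero element of `I` contains the highest
monomial of some element of `F` as a (contiguous) subword. -/
def IsGroebnerBasis [LinearOrder X] (F : Set (FreeAlgebra k X))
    (I : TwoSidedIdeal (FreeAlgebra k X)) : Prop :=
  (∀ g ∈ F, g ∈ I) ∧
    ∀ f ∈ I, f ≠ 0 → ∃ u, IsLeadingWord f u ∧ ∃ g ∈ F, ∃ v, IsLeadingWord g v ∧ v <:+: u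

end Groebner

/-! ### Binomial relations of skew-polynomial type -/

/-- The pairs `(j, i)` with `i < j`, indexing the monomials `x_j x_i` with `i < j`. -/
abbrev DescPair (n : ℕ) : Type := {p : Fin n × Fin n // p.2 < p.1}

/-- A set of `n(n-1)/2` binomial relations of skew-polynomial type in `x_1 < ⋯ < x_n`: one relation
`x_j x_i = c_{ij} x_{i'} x_{j'}` for each pair `i < j`. Here `coeff (j, i) = c_{ij}` and
`rhs (j, i) = (i', j')`. -/
structure SkewPolynomialRelations (k : Type*) [Field k] (n : ℕ) where
  /-- the coefficients `c_{ij}` -/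
  coeff : DescPair n → k
  /-- the pairs `(i', j')` -/
  rhs : DescPair n → Fin n × Fin n
  /-- each monomial `xy` with `x ≠ y` occurs in exactly one relation -/
  occurs_once : ∀ x y : Fin n, x ≠ y → ∃! p : DescPair n, p.1 = (x, y) ∨ rhs p = (x, y)
  /-- no monomial `xx` occurs in a relation -/
  square_free : ∀ (x : Fin n) (p : DescPair n), p.1 ≠ (x, x) ∧ rhs p ≠ (x, x)
  /-- `c_{ij} ≠ 0` -/
  coeff_ne_zero : ∀ p, coeff p ≠ 0
  /-- `j > i'` -/
  rhs_fst_lt : ∀ p, (rhs p).1 < p.1.1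
  /-- `i' < j'` -/
  rhs_lt : ∀ p, (rhs p).1 < (rhs p).2

namespace SkewPolynomialRelations

variable {k : Type*} [Field k] {n : ℕ} (S : SkewPolynomialRelations k n)

/-- The defining relation `x_j x_i - c_{ij} x_{i'} x_{j'}` as an element of `k⟨x_1, …, x_n⟩`. -/
noncomputable def relation (p : DescPair n) : FreeAlgebra k (Fin n) :=
  FreeAlgebra.ι k p.1.1 * FreeAlgebra.ι k p.1.2
    - S.coeff p • (FreeAlgebra.ι k (S.rhs p).1 * FreeAlgebra.ι k (S.rhs p).2)

/-- The set `ℜ₀` of all defining relations. -/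
def relations : Set (FreeAlgebra k (Fin n)) := Set.range S.relation

/-- The two-sided ideal `(ℜ₀)`. -/
def ideal : TwoSidedIdeal (FreeAlgebra k (Fin n)) := TwoSidedIdeal.span S.relations

/-- The algebra `A₀ = k⟨x_1, …, x_n⟩ / (ℜ₀)`. -/
abbrev algebra : Type _ := S.ideal.ringCon.Quotient

theorem exists_rhs_eq {x y : Fin n} (h : x < y) : ∃ p : DescPair n, S.rhs p = (x, y) := by
  obtain ⟨p, hp | hp, -⟩ := S.occurs_once x y h.ne
  · have := p.2
    rw [hp] at this
    exact absurd this h.not_gt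
  · exact ⟨p, hp⟩

/-- For `i' < j'`, the pair `(j, i)` whose relation has right-hand side `c_{ij} x_{i'} x_{j'}`. -/
noncomputable def lhs {x y : Fin n} (h : x < y) : DescPair n := (S.exists_rhs_eq h).choose

theorem rhs_lhs {x y : Fin n} (h : x < y) : S.rhs (S.lhs h) = (x, y) :=
  (S.exists_rhs_eq h).choose_spec

theorem lhs_eq {x y : Fin n} (h : x < y) (p : DescPair n) (hp : S.rhs p = (x, y)) :
    S.lhs h = p :=
  (S.occurs_once x y h.ne).unique (Or.inr (S.rhs_lhs h)) (Or.inr hp)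

variable {V : Type*} [AddCommGroup V] [Module k V] (b : Module.Basis (Fin n) k V)

/-- The value of `R(ℜ₀)` on the basis vector `x_a ⊗ x_c` of `V ⊗ V`. -/
noncomputable def autoFun (q : Fin n × Fin n) : V ⊗[k] V :=
  if h : q.2 < q.1 then S.coeff ⟨q, h⟩ • (b (S.rhs ⟨q, h⟩).1 ⊗ₜ[k] b (S.rhs ⟨q, h⟩).2)
  else if h' : q.1 < q.2 then
    (S.coeff (S.lhs h'))⁻¹ • (b (S.lhs h').1.1 ⊗ₜ[k] b (S.lhs h').1.2)
  else b q.1 ⊗ₜ[k] b q.2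

/-- The linear map `R(ℜ₀) : V ⊗ V → V ⊗ V`. -/
noncomputable def autoMap : (V ⊗[k] V) →ₗ[k] (V ⊗[k] V) :=
  (b.tensorProduct b).constr k (S.autoFun b)

theorem autoMap_tmul (x y : Fin n) : S.autoMap b (b x ⊗ₜ[k] b y) = S.autoFun b (x, y) := by
  rw [autoMap, ← Module.Basis.tensorProduct_apply, Module.Basis.constr_basis]

theorem autoMap_desc (p : DescPair n) :
    S.autoMap b (b p.1.1 ⊗ₜ[k] b p.1.2)
      = S.coeff p • (b (S.rhs p).1 ⊗ₜ[k] b (S.rhs p).2) := by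
  rw [autoMap_tmul, autoFun, dif_pos p.2]

theorem autoMap_asc (p : DescPair n) :
    S.autoMap b (b (S.rhs p).1 ⊗ₜ[k] b (S.rhs p).2)
      = (S.coeff p)⁻¹ • (b p.1.1 ⊗ₜ[k] b p.1.2) := by
  have h := S.rhs_lt p
  rw [autoMap_tmul, autoFun, dif_neg h.not_gt, dif_pos h, S.lhs_eq h p rfl]

theorem autoMap_diag (x : Fin n) : S.autoMap b (b x ⊗ₜ[k] b x) = b x ⊗ₜ[k] b x := by
  rw [autoMap_tmul, autoFun, dif_neg (lt_irrefl _), dif_neg (lt_irrefl _)]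

theorem autoMap_involutive : Function.Involutive (S.autoMap b) := by
  have h : S.autoMap b ∘ₗ S.autoMap b = LinearMap.id := by
    refine (b.tensorProduct b).ext fun q => ?_
    obtain ⟨x, y⟩ := q
    rw [Module.Basis.tensorProduct_apply, LinearMap.comp_apply, LinearMap.id_apply]
    rcases lt_trichotomy x y with hxy | rfl | hxy
    · have hp := S.rhs_lhs hxy
      have h1 := S.autoMap_asc b (S.lhs hxy)
      rw [hp] at h1
      rw [h1, map_smul, S.autoMap_desc b (S.lhs hxy), hp, smul_smul,
        inv_mul_cancel₀ (S.coeff_ne_zero _), one_smul]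
    · rw [autoMap_diag, autoMap_diag]
    · have h1 := S.autoMap_desc b ⟨(x, y), hxy⟩
      rw [h1, map_smul, S.autoMap_asc b, smul_smul, mul_inv_cancel₀ (S.coeff_ne_zero _), one_smul]
  exact fun v => LinearMap.congr_fun h v

/-- The linear automorphism `R(ℜ₀)` of `V ⊗ V`, where `V` has basis `x_1, …, x_n`:
`R(x_j ⊗ x_i) = c_{ij} x_{i'} ⊗ x_{j'}` and `R(x_{i'} ⊗ x_{j'}) = c_{ij}⁻¹ x_j ⊗ x_i` for `i < j`,
and `R(x_i ⊗ x_i) = x_i ⊗ x_i`. -/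
noncomputable def automorphism : (V ⊗[k] V) ≃ₗ[k] (V ⊗[k] V) :=
  LinearEquiv.ofInvolutive (S.autoMap b) (S.autoMap_involutive b)

end SkewPolynomialRelations

/-! Both conditions are equivalent to a statement about words of length three, recorded in
`ScalarNormalForm`: modulo the moves `R ⊗ id` and `id ⊗ R`, each word is a nonzero scalar times a
unique weakly increasing (normal) word, with uniqueness of the scalar included.

Normal forms and Gröbner bases: the leading words are the descents `x_j x_i`, so two of them can
overlap only in a word of length three. The diamond lemma then extends normal forms from length
three to all lengths. Conversely, the Gröbner property forbids congruences between distinct normal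
words.

From Yang-Baxter to normal forms: the two moves are involutions satisfying the braid relation, so
they act on scaled words through the symmetric group of degree three. The orbit of a normal word has
at most as many elements as the word has rearrangements, and every word lies in such an orbit. The
rearrangements of all normal words number `n ^ 3` in total, so counting makes the orbits disjoint
and the scalars unique.

From normal forms to Yang-Baxter (the hard direction, `TripleNormalForm.braid`): only the underlying
involution `r` of pairs matters, since the scalars follow. The fibres of the normal form must be
shown to have at least as many elements as in the braided case; the same count then forces equality,
and a dihedral orbit of minimal size satisfies the braid relation. The lower bounds need `r` to be
nondegenerate, which is not assumed. It is deduced from signed sums over the words whose normal form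
has exactly one repeated letter: each move reverses the sign of the pair it acts on, so the sums
vanish, while all their terms have one sign and hence are zero. This gives `Repeats.fst_eq`, then
`map_snd_ne`, then `Repeats.snd_eq`, and finally `map_fst_injective`. -/

/-! ### Involutions of skew-polynomial type and their action on words of length three -/

/-- An involution of `X × X`, `X = {x_1 < ⋯ < x_n}`, which fixes the diagonal, exchanges descents
and ascents, and lowers the first letter of every descent. -/
structure SkewInvolution (n : ℕ) where
  /-- the underlying map -/
  map : Fin n × Fin n → Fin n × Fin n
  map_map : ∀ q, map (map q) = q
  map_diag : ∀ x, map (x, x) = (x, x)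
  map_asc : ∀ q, q.2 < q.1 → (map q).1 < (map q).2
  map_desc : ∀ q, q.1 < q.2 → (map q).2 < (map q).1
  map_fst_lt : ∀ q, q.2 < q.1 → (map q).1 < q.1

/-- Words of length three. -/
abbrev Triple (n : ℕ) : Type := Fin n × Fin n × Fin n

/-- The sign of a pair: `1` for a descent, `-1` for an ascent, `0` on the diagonal. -/
def pairSign {n : ℕ} (q : Fin n × Fin n) : ℤ :=
  if q.2 < q.1 then 1 else if q.1 < q.2 then -1 else 0

theorem pairSign_desc {n : ℕ} {x y : Fin n} (h : y < x) : pairSign (x, y) = 1 := by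
  simp [pairSign, h]

theorem pairSign_asc {n : ℕ} {x y : Fin n} (h : x < y) : pairSign (x, y) = -1 := by
  simp [pairSign, h, h.not_gt]

theorem pairSign_diag {n : ℕ} (x : Fin n) : pairSign (x, x) = 0 := by
  simp [pairSign]

theorem pairSign_swap {n : ℕ} (x y : Fin n) : pairSign (y, x) = -pairSign (x, y) := by
  rcases lt_trichotomy x y with h | rfl | h
  · rw [pairSign_desc h, pairSign_asc h]; rfl
  · rw [pairSign_diag]; rfl
  · rw [pairSign_desc h, pairSign_asc h]

theorem pairSign_cases {n : ℕ} (q : Fin n × Fin n) :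
    pairSign q = 1 ∨ pairSign q = 0 ∨ pairSign q = -1 := by
  obtain ⟨x, y⟩ := q
  rcases lt_trichotomy x y with h | rfl | h
  · exact Or.inr (Or.inr (pairSign_asc h))
  · exact Or.inr (Or.inl (pairSign_diag _))
  · exact Or.inl (pairSign_desc h)

namespace Triple

variable {n : ℕ}

/-- A word is normal if its letters increase weakly. -/
def IsNormal (w : Triple n) : Prop := w.1 ≤ w.2.1 ∧ w.2.1 ≤ w.2.2

/-- The sum of the signs of the two pairs of adjacent letters. -/
def height (w : Triple n) : ℤ := pairSign (w.1, w.2.1) + pairSign w.2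

/-- The reversed word. -/
def rev (w : Triple n) : Triple n := (w.2.2, w.2.1, w.1)

theorem rev_rev (w : Triple n) : rev (rev w) = w := rfl

theorem height_rev (w : Triple n) : height (rev w) = -height w := by
  obtain ⟨x, y, z⟩ := w
  simp only [height, rev]
  rw [pairSign_swap y z, pairSign_swap x y]
  ring

/-- A descent contributes `1` and the other pair at least `-1`, so a word of negative height has no
descent. -/
theorem isNormal_of_height_neg {w : Triple n} (h : height w < 0) : IsNormal w := by
  obtain ⟨x, y, z⟩ := w
  simp only [height] at h
  simp only [IsNormal]
  constructor
  · by_contra! hc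
    rw [pairSign_desc hc] at h
    rcases pairSign_cases (y, z) with h' | h' | h' <;> omega
  · by_contra! hc
    rw [pairSign_desc hc] at h
    rcases pairSign_cases (x, y) with h' | h' | h' <;> omega

theorem height_cases (w : Triple n) :
    height w = 2 ∨ height w = 1 ∨ height w = 0 ∨ height w = -1 ∨ height w = -2 := by
  simp only [height]
  rcases pairSign_cases (w.1, w.2.1) with h | h | h <;> rcases pairSign_cases w.2 with h' | h' | h' <;>
    omega

end Triple

namespace SkewInvolution

variable {n : ℕ} (r : SkewInvolution n)

theorem pairSign_map (q : Fin n × Fin n) : pairSign (r.map q) = -pairSign q := by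
  obtain ⟨x, y⟩ := q
  rcases lt_trichotomy x y with h | rfl | h
  · rw [pairSign_asc h, ← Prod.mk.eta (p := r.map (x, y)), pairSign_desc (r.map_desc (x, y) h)]; rfl
  · rw [r.map_diag, pairSign_diag]; rfl
  · rw [pairSign_desc h, ← Prod.mk.eta (p := r.map (x, y)), pairSign_asc (r.map_asc (x, y) h)]

theorem lt_map_fst {x y : Fin n} (h : x < y) : x < (r.map (x, y)).1 := by
  have := r.map_fst_lt _ (r.map_desc (x, y) h)
  rwa [r.map_map] at this

theorem map_fst_lt_iff {x y : Fin n} : (r.map (x, y)).1 < x ↔ y < x := by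
  refine ⟨fun h => ?_, r.map_fst_lt (x, y)⟩
  rcases lt_trichotomy x y with h' | rfl | h'
  · exact absurd h (r.lt_map_fst h').not_gt
  · rw [r.map_diag] at h; exact absurd h (lt_irrefl _)
  · exact h'

theorem lt_map_fst_iff {x y : Fin n} : x < (r.map (x, y)).1 ↔ x < y := by
  refine ⟨fun h => ?_, r.lt_map_fst⟩
  rcases lt_trichotomy x y with h' | rfl | h'
  · exact h'
  · rw [r.map_diag] at h; exact absurd h (lt_irrefl _)
  · exact absurd h (r.map_fst_lt (x, y) h').not_gt

theorem map_fst_eq_iff {x y : Fin n} : (r.map (x, y)).1 = x ↔ x = y := by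
  refine ⟨fun h => ?_, fun h => by subst h; rw [r.map_diag]⟩
  rcases lt_trichotomy x y with h' | h' | h'
  · exact absurd h (r.lt_map_fst h').ne'
  · exact h'
  · exact absurd h (r.map_fst_lt (x, y) h').ne

/-- The involution applied to the first two letters. -/
def left (w : Triple n) : Triple n := ((r.map (w.1, w.2.1)).1, (r.map (w.1, w.2.1)).2, w.2.2)

/-- The involution applied to the last two letters. -/
def right (w : Triple n) : Triple n := (w.1, r.map w.2)

theorem left_left (w : Triple n) : r.left (r.left w) = w := by
  simp [left, r.map_map]

theorem right_right (w : Triple n) : r.right (r.right w) = w := by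
  simp [right, r.map_map]

theorem sum_eq_zero_of_left {f : Triple n → ℤ} (h : ∀ w, f (r.left w) = -f w) : ∑ w, f w = 0 := by
  have h1 : ∑ w, f (r.left w) = ∑ w, f w :=
    Equiv.sum_comp (Function.Involutive.toPerm r.left r.left_left) f
  simp only [h, Finset.sum_neg_distrib] at h1
  omega

theorem sum_eq_zero_of_right {f : Triple n → ℤ} (h : ∀ w, f (r.right w) = -f w) :
    ∑ w, f w = 0 := by
  have h1 : ∑ w, f (r.right w) = ∑ w, f w :=
    Equiv.sum_comp (Function.Involutive.toPerm r.right r.right_right) f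
  simp only [h, Finset.sum_neg_distrib] at h1
  omega

theorem sum_pair_map (f : Fin n × Fin n → ℤ) : ∑ q, f (r.map q) = ∑ q, f q :=
  Equiv.sum_comp (Function.Involutive.toPerm r.map r.map_map) f

end SkewInvolution

/-! ### Heights on the fibres of a normal form -/

/-- A normal form for words of length three: a map onto the normal words which is constant on the
orbits of `r × id` and `id × r`. -/
structure TripleNormalForm {n : ℕ} (r : SkewInvolution n) where
  /-- the normal form of a word -/
  nf : Triple n → Triple n
  nf_left : ∀ w, nf (r.left w) = nf w
  nf_right : ∀ w, nf (r.right w) = nf w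
  isNormal_nf : ∀ w, (nf w).IsNormal
  nf_eq : ∀ w : Triple n, w.IsNormal → nf w = w

namespace TripleNormalForm

open Triple

variable {n : ℕ} {r : SkewInvolution n} (N : TripleNormalForm r)

/-- Each of the two signs making up `height` is negated by one of the moves, and both moves preserve
the fibre. -/
theorem sum_height (u : Triple n) : (∑ w, if N.nf w = u then height w else 0) = 0 := by
  have h1 : (∑ w : Triple n, if N.nf w = u then pairSign (w.1, w.2.1) else 0) = 0 := by
    refine r.sum_eq_zero_of_left fun w => ?_
    have : pairSign ((r.left w).1, (r.left w).2.1) = -pairSign (w.1, w.2.1) :=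
      r.pairSign_map (w.1, w.2.1)
    rw [N.nf_left, this]
    split_ifs <;> simp
  have h2 : (∑ w : Triple n, if N.nf w = u then pairSign w.2 else 0) = 0 := by
    refine r.sum_eq_zero_of_right fun w => ?_
    have : pairSign (r.right w).2 = -pairSign w.2 := r.pairSign_map w.2
    rw [N.nf_right, this]
    split_ifs <;> simp
  calc (∑ w, if N.nf w = u then height w else 0)
      = ∑ w : Triple n, ((if N.nf w = u then pairSign (w.1, w.2.1) else 0)
          + if N.nf w = u then pairSign w.2 else 0) :=
        Finset.sum_congr rfl fun w _ => by split_ifs <;> simp [height]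
    _ = 0 := by rw [Finset.sum_add_distrib, h1, h2, add_zero]

theorem nf_eq_of_height_neg {w : Triple n} (h : height w < 0) : N.nf w = w :=
  N.nf_eq w (isNormal_of_height_neg h)

/-- The orbit of a normal word `u` with exactly one repeated letter contains exactly one word of
height `1`, and none of height `2`. -/
theorem orbit_of_height_neg_one {u : Triple n} (hu : height u = -1) :
    (∀ w, N.nf w = u → height w ≠ 2) ∧
      (∑ w, if N.nf w = u ∧ height w = 1 then (1 : ℤ) else 0) = 1 := by
  have hnf : N.nf u = u := N.nf_eq_of_height_neg (by omega)
  -- In its fibre `u` is the only word of negative height. Adding `1` at `u` cancels its `-1`,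
  -- leaving nonnegative integers with sum `1`.
  have hsum : ∑ w, ((if N.nf w = u then height w else 0) + if w = u then (1 : ℤ) else 0) = 1 := by
    rw [Finset.sum_add_distrib, N.sum_height]
    simp
  have hnn : ∀ w, 0 ≤ (if N.nf w = u then height w else 0) + if w = u then (1 : ℤ) else 0 := by
    intro w
    by_cases hw : w = u
    · subst hw
      simp [hnf, hu]
    · by_cases hn : N.nf w = u
      · have : ¬ height w < 0 := fun h => hw ((N.nf_eq_of_height_neg h).symm.trans hn)
        simp only [hn, hw, if_true, if_false]
        omega
      · simp [hn, hw]
  have h2 : ∀ w, N.nf w = u → height w ≠ 2 := by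
    intro w hw h
    have := Finset.single_le_sum (fun w _ => hnn w) (Finset.mem_univ w)
    rw [hsum, if_pos hw, h] at this
    split_ifs at this <;> omega
  refine ⟨h2, ?_⟩
  refine (Finset.sum_congr rfl fun w _ => ?_).trans hsum
  by_cases hw : w = u
  · subst hw
    simp [hnf, hu]
  · by_cases hn : N.nf w = u
    · have h3 : ¬ height w < 0 := fun h => hw ((N.nf_eq_of_height_neg h).symm.trans hn)
      have h4 := h2 w hn
      simp only [hn, hw, true_and, if_true, if_false]
      rcases height_cases w with h | h | h | h | h <;> simp [h] <;> omega
    · simp [hn, hw]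

theorem height_nf_of_height_neg_one {w : Triple n} (h : height w = -1) :
    height (N.nf w) = -1 := by
  rw [N.nf_eq_of_height_neg (by omega), h]

theorem height_ne_two_of_height_nf {w : Triple n} (h : height (N.nf w) = -1) : height w ≠ 2 :=
  (N.orbit_of_height_neg_one h).1 w rfl

theorem height_ne_neg_two_of_height_nf {w : Triple n} (h : height (N.nf w) = -1) :
    height w ≠ -2 := by
  intro h'
  rw [N.nf_eq_of_height_neg (by omega)] at h
  omega

/-- Each `u` of height `-1` has exactly one word of height `1` in its fibre, and reversal gives as
many words of height `1` as of height `-1`. Hence no word of height `1` is left for other fibres. -/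
theorem height_nf_of_height_one {w : Triple n} (h : height w = 1) : height (N.nf w) = -1 := by
  have h1 : (∑ w, if height (N.nf w) = -1 ∧ height w = 1 then (1 : ℤ) else 0)
      = ∑ u : Triple n, if height u = -1 then (1 : ℤ) else 0 := by
    calc _ = ∑ w, ∑ u, (if height u = -1 then
              if N.nf w = u ∧ height w = 1 then (1 : ℤ) else 0 else 0) := by
          refine Finset.sum_congr rfl fun w _ => ?_
          rw [Finset.sum_eq_single (N.nf w)]
          · by_cases h1 : height (N.nf w) = -1 <;> simp [h1]
          · intro u _ hu
            simp [hu.symm]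
          · simp
      _ = _ := by
          rw [Finset.sum_comm]
          refine Finset.sum_congr rfl fun u _ => ?_
          by_cases hu : height u = -1
          · simp only [hu, if_true]
            exact (N.orbit_of_height_neg_one hu).2
          · simp [hu]
  have h2 : (∑ u : Triple n, if height u = -1 then (1 : ℤ) else 0)
      = ∑ u : Triple n, if height u = 1 then (1 : ℤ) else 0 := by
    refine (Equiv.sum_comp (Function.Involutive.toPerm rev rev_rev) _).symm.trans
      (Finset.sum_congr rfl fun w _ => ?_)
    change (if height (rev w) = -1 then (1 : ℤ) else 0) = _
    simp only [height_rev, neg_inj]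
  -- A word of height `1` outside these fibres would make the first count strictly smaller than the
  -- last.
  by_contra hc
  have h3 : (∑ w, if height (N.nf w) = -1 ∧ height w = 1 then (1 : ℤ) else 0)
      < ∑ u : Triple n, if height u = 1 then (1 : ℤ) else 0 := by
    refine Finset.sum_lt_sum (fun w _ => ?_) ⟨w, Finset.mem_univ w, ?_⟩
    · by_cases h4 : height w = 1 <;> by_cases h5 : height (N.nf w) = -1 <;> simp [h4, h5]
    · simp [h, hc]
  omega

/-- The set of words whose normal form has exactly one repeated letter. -/
def Repeats (w : Triple n) : Prop := height (N.nf w) = -1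

instance : DecidablePred N.Repeats := fun w => inferInstanceAs (Decidable (height (N.nf w) = -1))

theorem repeats_left {w : Triple n} : N.Repeats (r.left w) ↔ N.Repeats w := by
  rw [Repeats, N.nf_left, Repeats]

theorem repeats_right {w : Triple n} : N.Repeats (r.right w) ↔ N.Repeats w := by
  rw [Repeats, N.nf_right, Repeats]

theorem repeats_of_height {w : Triple n} (h : height w = 1 ∨ height w = -1) : N.Repeats w :=
  h.elim N.height_nf_of_height_one N.height_nf_of_height_neg_one

theorem repeats_aab {x y : Fin n} (h : x ≠ y) : N.Repeats (x, x, y) := by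
  apply N.repeats_of_height
  simp only [height, pairSign_diag, zero_add]
  rcases h.lt_or_gt with h | h
  · exact Or.inr (pairSign_asc h)
  · exact Or.inl (pairSign_desc h)

theorem repeats_abb {x y : Fin n} (h : x ≠ y) : N.Repeats (x, y, y) := by
  apply N.repeats_of_height
  simp only [height, pairSign_diag, add_zero]
  rcases h.lt_or_gt with h | h
  · exact Or.inr (pairSign_asc h)
  · exact Or.inl (pairSign_desc h)

theorem Repeats.not_asc {x y z : Fin n} (h : N.Repeats (x, y, z)) (h1 : x < y) : ¬ y < z := by
  intro h2
  refine N.height_ne_neg_two_of_height_nf h ?_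
  simp [height, pairSign_asc h1, pairSign_asc h2]

theorem Repeats.not_desc {x y z : Fin n} (h : N.Repeats (x, y, z)) (h1 : y < x) : ¬ z < y := by
  intro h2
  refine N.height_ne_two_of_height_nf h ?_
  simp [height, pairSign_desc h1, pairSign_desc h2]

/-- The contribution of a word to a telescoping sum over the words in `Repeats`. -/
theorem indicator_mul_height (w : Triple n) :
    (if N.Repeats w then height w else 0)
      = (if w.1 = w.2.1 then pairSign w.2 else 0)
        + if w.2.1 = w.2.2 then pairSign (w.1, w.2.1) else 0 := by
  obtain ⟨x, y, z⟩ := w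
  simp only
  by_cases h1 : x = y
  · subst h1
    by_cases h2 : x = z
    · subst h2
      simp [height, pairSign_diag]
    · simp [N.repeats_aab h2, h2, height, pairSign_diag]
  · by_cases h2 : y = z
    · subst h2
      simp [N.repeats_abb h1, h1, height, pairSign_diag]
    · simp only [h1, h2, if_false, add_zero]
      -- With both adjacent pairs unequal, a word in `Repeats` cannot be monotone, so its two signs
      -- cancel.
      split_ifs with h
      · simp only [height]
        rcases lt_or_gt_of_ne h1 with h1 | h1 <;> rcases lt_or_gt_of_ne h2 with h2 | h2
        · exact absurd h2 (h.not_asc N h1)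
        · rw [pairSign_asc h1, pairSign_desc h2]; rfl
        · rw [pairSign_desc h1, pairSign_asc h2]; rfl
        · exact absurd h2 (h.not_desc N h1)
      · rfl

end TripleNormalForm

/-! ### Signed sums and nondegeneracy of the involution -/

namespace TripleNormalForm

open Triple

variable {n : ℕ} {r : SkewInvolution n} (N : TripleNormalForm r)

/-- The number of letters `z` such that `z q` lies in `Repeats`. -/
def countBefore (q : Fin n × Fin n) : ℤ := ∑ z : Fin n, if N.Repeats (z, q) then 1 else 0

/-- The number of letters `z` such that `q z` lies in `Repeats`. -/
def countAfter (q : Fin n × Fin n) : ℤ := ∑ z : Fin n, if N.Repeats (q.1, q.2, z) then 1 else 0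

theorem countBefore_map (q : Fin n × Fin n) : N.countBefore (r.map q) = N.countBefore q := by
  refine Finset.sum_congr rfl fun z _ => ?_
  have := N.repeats_right (w := (z, q))
  simp only [SkewInvolution.right] at this
  simp only [this]

theorem countAfter_map (q : Fin n × Fin n) : N.countAfter (r.map q) = N.countAfter q := by
  refine Finset.sum_congr rfl fun z _ => ?_
  have := N.repeats_left (w := (q.1, q.2, z))
  simp only [SkewInvolution.left] at this
  simp only [this]

/-- Sum `height w` times the last letter over `Repeats`. The sign of the first pair cancels under
`left`, leaving the sum with `countBefore`. By `indicator_mul_height` only the words `xxy` and `xyy`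
contribute; each type gives the same sum over pairs, whence the `2`. -/
theorem sum_countBefore :
    ∑ q : Fin n × Fin n, pairSign q * (q.2 : ℤ) * (N.countBefore q - 2) = 0 := by
  have h1 : ∑ w : Triple n, (if N.Repeats w then pairSign (w.1, w.2.1) * (w.2.2 : ℤ) else 0) = 0 := by
    refine r.sum_eq_zero_of_left fun w => ?_
    have h : pairSign ((r.left w).1, (r.left w).2.1) = -pairSign (w.1, w.2.1) :=
      r.pairSign_map (w.1, w.2.1)
    have h' : (r.left w).2.2 = w.2.2 := rfl
    simp only [N.repeats_left, h, h']
    split_ifs <;> ring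
  have h2 : ∑ w : Triple n, (if N.Repeats w then pairSign w.2 * (w.2.2 : ℤ) else 0)
      = ∑ q : Fin n × Fin n, pairSign q * (q.2 : ℤ) * N.countBefore q := by
    rw [Fintype.sum_prod_type_right]
    refine Finset.sum_congr rfl fun q _ => ?_
    rw [countBefore, Finset.mul_sum]
    exact Finset.sum_congr rfl fun z _ => by split_ifs <;> simp
  have h3 : ∑ w : Triple n, (if w.1 = w.2.1 then pairSign w.2 else 0) * (w.2.2 : ℤ)
      = ∑ q : Fin n × Fin n, pairSign q * (q.2 : ℤ) := by
    rw [Fintype.sum_prod_type_right]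
    refine Finset.sum_congr rfl fun q _ => ?_
    simp
  have h4 : ∑ w : Triple n, (if w.2.1 = w.2.2 then pairSign (w.1, w.2.1) else 0) * (w.2.2 : ℤ)
      = ∑ q : Fin n × Fin n, pairSign q * (q.2 : ℤ) := by
    simp only [Fintype.sum_prod_type]
    refine Finset.sum_congr rfl fun x _ => Finset.sum_congr rfl fun y _ => ?_
    simp
  have h5 : ∑ w : Triple n, (if N.Repeats w then height w else 0) * (w.2.2 : ℤ)
      = ∑ q : Fin n × Fin n, pairSign q * (q.2 : ℤ) * N.countBefore q := by
    calc _ = ∑ w : Triple n, ((if N.Repeats w then pairSign (w.1, w.2.1) * (w.2.2 : ℤ) else 0)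
          + if N.Repeats w then pairSign w.2 * (w.2.2 : ℤ) else 0) :=
          Finset.sum_congr rfl fun w _ => by simp only [height]; split_ifs <;> ring
      _ = _ := by rw [Finset.sum_add_distrib, h1, h2, zero_add]
  simp only [N.indicator_mul_height, add_mul, Finset.sum_add_distrib, h3, h4] at h5
  simp only [mul_sub, Finset.sum_sub_distrib, ← h5, ← Finset.sum_mul]
  ring

/-- The mirror image of `sum_countBefore`, weighted by the first letter and using cancellation under
`right`. -/
theorem sum_countAfter :
    ∑ q : Fin n × Fin n, pairSign q * (q.1 : ℤ) * (N.countAfter q - 2) = 0 := by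
  have h1 : ∑ w : Triple n, (if N.Repeats w then pairSign w.2 * (w.1 : ℤ) else 0) = 0 := by
    refine r.sum_eq_zero_of_right fun w => ?_
    have h : pairSign (r.right w).2 = -pairSign w.2 := r.pairSign_map w.2
    have h' : (r.right w).1 = w.1 := rfl
    simp only [N.repeats_right, h, h']
    split_ifs <;> ring
  have h2 : ∑ w : Triple n, (if N.Repeats w then pairSign (w.1, w.2.1) * (w.1 : ℤ) else 0)
      = ∑ q : Fin n × Fin n, pairSign q * (q.1 : ℤ) * N.countAfter q := by
    simp only [Fintype.sum_prod_type]
    refine Finset.sum_congr rfl fun x _ => Finset.sum_congr rfl fun y _ => ?_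
    rw [countAfter, Finset.mul_sum]
    exact Finset.sum_congr rfl fun z _ => by split_ifs <;> simp
  have h3 : ∑ w : Triple n, (if w.1 = w.2.1 then pairSign w.2 else 0) * (w.1 : ℤ)
      = ∑ q : Fin n × Fin n, pairSign q * (q.1 : ℤ) := by
    rw [Fintype.sum_prod_type_right]
    refine Finset.sum_congr rfl fun q _ => ?_
    simp
  have h4 : ∑ w : Triple n, (if w.2.1 = w.2.2 then pairSign (w.1, w.2.1) else 0) * (w.1 : ℤ)
      = ∑ q : Fin n × Fin n, pairSign q * (q.1 : ℤ) := by
    simp only [Fintype.sum_prod_type]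
    refine Finset.sum_congr rfl fun x _ => Finset.sum_congr rfl fun y _ => ?_
    simp
  have h5 : ∑ w : Triple n, (if N.Repeats w then height w else 0) * (w.1 : ℤ)
      = ∑ q : Fin n × Fin n, pairSign q * (q.1 : ℤ) * N.countAfter q := by
    calc _ = ∑ w : Triple n, ((if N.Repeats w then pairSign (w.1, w.2.1) * (w.1 : ℤ) else 0)
          + if N.Repeats w then pairSign w.2 * (w.1 : ℤ) else 0) :=
          Finset.sum_congr rfl fun w _ => by simp only [height]; split_ifs <;> ring
      _ = _ := by rw [Finset.sum_add_distrib, h1, h2, add_zero]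
  simp only [N.indicator_mul_height, add_mul, Finset.sum_add_distrib, h3, h4] at h5
  simp only [mul_sub, Finset.sum_sub_distrib, ← h5, ← Finset.sum_mul]
  ring

/-- If `∑ ± f(q) g(q) = 0` for a `map`-invariant function `g` and `f` does not go up from
descents to ascents, then all contributions vanish. -/
theorem _root_.SkewInvolution.mul_eq_zero_of_sum (r : SkewInvolution n) {f g : Fin n × Fin n → ℤ}
    (hsum : ∑ q, pairSign q * f q * g q = 0) (hg : ∀ q, g (r.map q) = g q)
    (hpos : ∀ q, q.2 < q.1 → 0 ≤ (f q - f (r.map q)) * g q) {q : Fin n × Fin n} (hq : q.2 < q.1) :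
    (f q - f (r.map q)) * g q = 0 := by
  -- Reindexing by `r` reverses the sign and fixes `g`, so the sum with `f ∘ r.map` vanishes as
  -- well. After antisymmetrization the term at an ascent equals the term at the corresponding
  -- descent.
  have h1 : ∑ q, pairSign q * (f q - f (r.map q)) * g q = 0 := by
    have h2 : ∑ q, pairSign q * f (r.map q) * g q = 0 := by
      rw [← r.sum_pair_map]
      simp only [r.map_map, hg, r.pairSign_map, neg_mul, Finset.sum_neg_distrib, hsum, neg_zero]
    rw [← sub_zero (0 : ℤ)]
    nth_rw 1 [← hsum]
    rw [← h2, ← Finset.sum_sub_distrib]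
    exact Finset.sum_congr rfl fun q _ => by ring
  have hnn : ∀ q, 0 ≤ pairSign q * (f q - f (r.map q)) * g q := by
    rintro ⟨x, y⟩
    rcases lt_trichotomy x y with h | rfl | h
    · have := hpos _ (r.map_desc (x, y) h)
      rw [r.map_map, hg] at this
      rw [pairSign_asc h]
      linarith
    · simp [pairSign_diag]
    · have := hpos (x, y) h
      rw [pairSign_desc h]
      linarith
  have h3 := (Finset.sum_eq_zero_iff_of_nonneg fun q _ => hnn q).1 h1 q (Finset.mem_univ q)
  rw [← Prod.mk.eta (p := q), pairSign_desc hq, one_mul] at h3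
  exact h3

theorem two_le_sum_indicator {P : Fin n → Prop} [DecidablePred P] {a b : Fin n} (hab : a ≠ b)
    (ha : P a) (hb : P b) : 2 ≤ ∑ z, if P z then (1 : ℤ) else 0 := by
  rw [Finset.sum_boole]
  have : ({a, b} : Finset (Fin n)) ⊆ Finset.univ.filter P := by
    intro z hz
    rcases Finset.mem_insert.1 hz with rfl | hz
    · simpa using ha
    · rw [Finset.mem_singleton.1 hz]; simpa using hb
  have := Finset.card_le_card this
  rw [Finset.card_pair hab] at this
  exact_mod_cast this

theorem eq_or_eq_of_sum_indicator {P : Fin n → Prop} [DecidablePred P] {a b z : Fin n} (hab : a ≠ b)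
    (ha : P a) (hb : P b) (h : (∑ z, if P z then (1 : ℤ) else 0) - 2 = 0) (hz : P z) :
    z = a ∨ z = b := by
  by_contra! hc
  rw [Finset.sum_boole] at h
  have : ({z, a, b} : Finset (Fin n)) ⊆ Finset.univ.filter P := by
    intro u hu
    simp only [Finset.mem_insert, Finset.mem_singleton] at hu
    rcases hu with rfl | rfl | rfl <;> simpa
  have := Finset.card_le_card this
  rw [Finset.card_insert_of_notMem (by simp [hc.1, hc.2]), Finset.card_pair hab] at this
  have : (3 : ℤ) ≤ (Finset.univ.filter P).card := by exact_mod_cast this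
  linarith

/-- Otherwise `left` would send `(y, x, x)`, which is in `Repeats`, to a strictly increasing word.
-/
theorem le_map_snd (N : TripleNormalForm r) {x y : Fin n} (h : x < y) : x ≤ (r.map (y, x)).2 := by
  by_contra! hc
  have h1 := N.repeats_left.2 (N.repeats_abb h.ne')
  exact Repeats.not_asc N h1 (r.map_asc (y, x) h) hc

/-- In `Repeats`, a pair `y x` with `y > x`, `r (y, x) = (a, b)`, `b ≠ x`, is only preceded by
`y` or `a`. -/
theorem Repeats.fst_eq {N : TripleNormalForm r} {z x y : Fin n} (hz : N.Repeats (z, y, x))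
    (h : x < y) (hb : (r.map (y, x)).2 ≠ x) : z = y ∨ z = (r.map (y, x)).1 := by
  have hy : N.Repeats (y, y, x) := N.repeats_aab h.ne'
  -- With `r q = (a, b)`, the word `(a, a, b)` is in `Repeats`, and `right` replaces its last pair
  -- by `q`.
  have ha : ∀ q : Fin n × Fin n, q.2 < q.1 → N.Repeats ((r.map q).1, q) := by
    intro q hq
    have : N.Repeats ((r.map q).1, r.map q) := N.repeats_aab (r.map_asc q hq).ne
    rw [← N.repeats_right] at this
    simpa only [SkewInvolution.right, r.map_map] using this
  have hsum : ∑ q : Fin n × Fin n, pairSign q * -(q.2 : ℤ) * (N.countBefore q - 2) = 0 := by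
    simp only [mul_neg, neg_mul, Finset.sum_neg_distrib, N.sum_countBefore, neg_zero]
  -- The weight is minus the second letter, which by `le_map_snd` does not increase from a descent
  -- to its image. Two predecessors are known, so `countBefore - 2` is nonnegative; it vanishes when
  -- the second letter changes.
  have h0 := r.mul_eq_zero_of_sum (f := fun q => -(q.2 : ℤ)) (g := fun q => N.countBefore q - 2)
    hsum (fun q => by rw [N.countBefore_map]) (fun q hq => ?_) (q := (y, x)) h
  · rcases mul_eq_zero.1 h0 with h1 | h1
    · exact absurd (Fin.ext (by simp only at h1; omega)) hb
    · exact eq_or_eq_of_sum_indicator (P := fun z => N.Repeats (z, y, x)) (r.map_fst_lt (y, x) h).ne'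
        hy (ha (y, x) h) h1 hz
  · have h1 : 2 ≤ N.countBefore q :=
      two_le_sum_indicator (P := fun z => N.Repeats (z, q)) (r.map_fst_lt q hq).ne'
        (N.repeats_aab hq.ne') (ha q hq)
    have h2 : q.2 ≤ (r.map q).2 := N.le_map_snd (x := q.2) (y := q.1) hq
    have h3 : (q.2 : ℤ) ≤ ((r.map q).2 : ℤ) := by exact_mod_cast h2
    exact mul_nonneg (by linarith) (by linarith)

/-- If `r (y, v) = (a, b)`, then `(a, b, v)` is in `Repeats` and `(b, v)` is a descent. As `a < b`,
`Repeats.fst_eq` leaves only `a = (r.map (b, v)).1`. So `b` determines `a`, hence the pair `(y, v)`.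
-/
theorem map_snd_injective_of_ne (N : TripleNormalForm r) {v : Fin n}
    (hv : ∀ y, v < y → (r.map (y, v)).2 ≠ v) {y₁ y₂ : Fin n} (h₁ : v < y₁) (h₂ : v < y₂)
    (h : (r.map (y₁, v)).2 = (r.map (y₂, v)).2) : y₁ = y₂ := by
  have key : ∀ y, v < y → (r.map (y, v)).1 = (r.map ((r.map (y, v)).2, v)).1 := by
    intro y hy
    have h1 : v < (r.map (y, v)).2 := lt_of_le_of_ne (N.le_map_snd hy) (hv y hy).symm
    have h2 : N.Repeats ((r.map (y, v)).1, (r.map (y, v)).2, v) :=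
      N.repeats_left.2 (N.repeats_abb hy.ne')
    exact (h2.fst_eq h1 (hv _ h1)).resolve_left (r.map_asc (y, v) hy).ne
  have h3 : r.map (y₁, v) = r.map (y₂, v) := Prod.ext (by rw [key _ h₁, key _ h₂, h]) h
  have h4 := congrArg r.map h3
  rw [r.map_map, r.map_map] at h4
  exact congrArg Prod.fst h4

/-- The map sending `y` to the second letter of `r (y, v)` is an injection of the finite set of
letters above `v` into itself, so it takes the value `z`. -/
theorem exists_map_snd_eq (N : TripleNormalForm r) {v z : Fin n}
    (hv : ∀ y, v < y → (r.map (y, v)).2 ≠ v) (hz : v < z) : ∃ c < z, (r.map (c, z)).2 = v := by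
  let f : {y // v < y} → {y // v < y} := fun y =>
    ⟨(r.map (y.1, v)).2, lt_of_le_of_ne (N.le_map_snd y.2) (hv y.1 y.2).symm⟩
  have hf : Function.Injective f := fun y₁ y₂ h =>
    Subtype.ext (N.map_snd_injective_of_ne hv y₁.2 y₂.2 (congrArg Subtype.val h))
  obtain ⟨⟨y, hy⟩, h⟩ := Finite.injective_iff_surjective.1 hf ⟨z, hz⟩
  have h' : (r.map (y, v)).2 = z := congrArg Subtype.val h
  refine ⟨(r.map (y, v)).1, h' ▸ r.map_asc (y, v) hy, ?_⟩
  rw [← h', Prod.mk.eta, r.map_map]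

/-- Strong induction on `z`. For each `v < z` there is `c v < z` such that `r (c v, z)` ends in `v`;
`c` is injective, hence a permutation of the letters below `z`. If `r (y, z) = (a, z)`, then `a = c
v` for some `v`, so `r (a, z)` ends in `v < z`; but it equals `(y, z)`. -/
theorem map_snd_ne (N : TripleNormalForm r) (z : Fin n) : ∀ y, z < y → (r.map (y, z)).2 ≠ z := by
  induction z using WellFoundedLT.induction with
  | ind z ih =>
    intro y hy h
    have hex : ∀ v : {v // v < z}, ∃ c : {v // v < z}, (r.map (c.1, z)).2 = v.1 := fun v => by
      obtain ⟨c, hc, h⟩ := N.exists_map_snd_eq (ih v.1 v.2) v.2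
      exact ⟨⟨c, hc⟩, h⟩
    choose c hc using hex
    have hinj : Function.Injective c := fun v₁ v₂ h => by
      apply Subtype.ext
      rw [← hc v₁, ← hc v₂, h]
    have ha : (r.map (y, z)).1 < z := by
      have := r.map_asc (y, z) hy
      rwa [h] at this
    obtain ⟨v, hv⟩ := Finite.injective_iff_surjective.1 hinj ⟨_, ha⟩
    have h1 := hc v
    rw [hv] at h1
    have h2 : r.map ((r.map (y, z)).1, z) = (y, z) := by
      have e : ((r.map (y, z)).1, z) = r.map (y, z) := Prod.ext rfl h.symm
      rw [e, r.map_map]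
    rw [h2] at h1
    exact v.2.ne h1.symm

/-- In `Repeats`, a pair `y x` with `y > x`, `r (y, x) = (a, b)`, is only followed by `x` or
`b`. -/
theorem Repeats.snd_eq {N : TripleNormalForm r} {z x y : Fin n} (hz : N.Repeats (y, x, z))
    (h : x < y) : z = x ∨ z = (r.map (y, x)).2 := by
  have hb : ∀ q : Fin n × Fin n, q.2 < q.1 → N.Repeats (q.1, q.2, (r.map q).2) := by
    intro q hq
    have : N.Repeats ((r.map q).1, (r.map q).2, (r.map q).2) := N.repeats_abb (r.map_asc q hq).ne
    rw [← N.repeats_left] at this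
    simpa only [SkewInvolution.left, r.map_map] using this
  -- Here the weight is the first letter, which strictly drops at every descent, so `countAfter = 2`
  -- at all descents. The two known followers are distinct by `map_snd_ne`.
  have h0 := r.mul_eq_zero_of_sum (f := fun q => (q.1 : ℤ)) (g := fun q => N.countAfter q - 2)
    N.sum_countAfter (fun q => by rw [N.countAfter_map]) (fun q hq => ?_) (q := (y, x)) h
  · rcases mul_eq_zero.1 h0 with h1 | h1
    · exact absurd (Fin.ext (by exact_mod_cast (sub_eq_zero.1 h1).symm)) (r.map_fst_lt (y, x) h).ne
    · exact eq_or_eq_of_sum_indicator (P := fun z => N.Repeats (y, x, z)) (N.map_snd_ne x y h).symm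
        (N.repeats_abb h.ne') (hb (y, x) h) h1 hz
  · have h1 : 2 ≤ N.countAfter q :=
      two_le_sum_indicator (P := fun z => N.Repeats (q.1, q.2, z)) (N.map_snd_ne q.2 q.1 hq).symm
        (N.repeats_abb hq.ne') (hb q hq)
    have h3 : ((r.map q).1 : ℤ) < (q.1 : ℤ) := by exact_mod_cast r.map_fst_lt q hq
    exact mul_nonneg (by linarith) (by linarith)

/-- The involution is left nondegenerate. -/
theorem map_fst_injective (N : TripleNormalForm r) {x y₁ y₂ : Fin n}
    (h : (r.map (x, y₁)).1 = (r.map (x, y₂)).1) : y₁ = y₂ := by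
  have hdesc : ∀ y, y < x → (r.map (x, y)).2 = (r.map (x, (r.map (x, y)).1)).2 := by
    intro y hy
    have h1 : N.Repeats (x, (r.map (x, y)).1, (r.map (x, y)).2) :=
      N.repeats_right.2 (N.repeats_aab hy.ne')
    exact (h1.snd_eq (r.map_fst_lt (x, y) hy)).resolve_left (r.map_asc (x, y) hy).ne'
  have hasc : ∀ y, x < y → (r.map (x, y)).2 = (r.map (x, (r.map (x, y)).1)).2 := by
    intro y hy
    have h1 : N.Repeats (x, (r.map (x, y)).1, (r.map (x, y)).2) :=
      N.repeats_right.2 (N.repeats_aab hy.ne)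
    have h2 := N.repeats_left.2 h1
    refine (h2.snd_eq (r.map_desc _ (r.lt_map_fst hy))).resolve_right ?_
    simp only [Prod.mk.eta, r.map_map]
    exact (r.map_desc (x, y) hy).ne
  -- The first letter of `r (x, y)` compares with `x` as `y` does, so `y₁` and `y₂` fall into the
  -- same case; there the first letter determines the second.
  have hsnd : (r.map (x, y₁)).2 = (r.map (x, y₂)).2 := by
    rcases lt_trichotomy y₁ x with h1 | rfl | h1
    · have h2 : y₂ < x := by rwa [← r.map_fst_lt_iff, ← h, r.map_fst_lt_iff]
      rw [hdesc _ h1, hdesc _ h2, h]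
    · rw [r.map_diag] at h
      obtain rfl := r.map_fst_eq_iff.1 h.symm
      rfl
    · have h2 : x < y₂ := by rwa [← r.lt_map_fst_iff, ← h, r.lt_map_fst_iff]
      rw [hasc _ h1, hasc _ h2, h]
  have h4 := congrArg r.map (Prod.ext h hsnd)
  rw [r.map_map, r.map_map] at h4
  exact congrArg Prod.snd h4

end TripleNormalForm

/-! ### Counting rearrangements of normal words -/

namespace Triple

variable {n : ℕ}

instance : DecidablePred (IsNormal (n := n)) := fun w =>
  inferInstanceAs (Decidable (w.1 ≤ w.2.1 ∧ w.2.1 ≤ w.2.2))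

/-- The number of distinct rearrangements of a normal word. -/
def permCount (u : Triple n) : ℕ :=
  if u.1 = u.2.1 then if u.2.1 = u.2.2 then 1 else 3 else if u.2.1 = u.2.2 then 3 else 6

/-- The weakly increasing rearrangement of a word. -/
def sort (w : Triple n) : Triple n :=
  (min w.1 (min w.2.1 w.2.2), max (min w.1 w.2.1) (min (max w.1 w.2.1) w.2.2),
    max w.1 (max w.2.1 w.2.2))

theorem isNormal_sort (w : Triple n) : IsNormal (sort w) := by
  obtain ⟨x, y, z⟩ := w
  simp only [IsNormal, sort]
  constructor
  · simp only [le_max_iff, le_min_iff, min_le_iff]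
    simp only [le_refl, true_or, or_true, true_and]
  · simp only [le_max_iff, max_le_iff, min_le_iff]
    rcases le_total y z with h | h <;> simp [h]

theorem sort_eq_iff {a b c : Fin n} (hab : a ≤ b) (hbc : b ≤ c) (w : Triple n) :
    sort w = (a, b, c) ↔ w ∈ ({(a, b, c), (b, a, c), (a, c, b), (c, a, b), (b, c, a), (c, b, a)} :
      Finset (Triple n)) := by
  obtain ⟨x, y, z⟩ := w
  simp only [sort, Finset.mem_insert, Finset.mem_singleton, Prod.mk.injEq]
  constructor
  · rintro ⟨h1, h2, h3⟩
    rcases le_total x y with hxy | hxy <;> rcases le_total y z with hyz | hyz <;>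
      rcases le_total x z with hxz | hxz <;> simp_all <;> grind
  · have hac := hab.trans hbc
    rintro (⟨rfl, rfl, rfl⟩ | ⟨rfl, rfl, rfl⟩ | ⟨rfl, rfl, rfl⟩ | ⟨rfl, rfl, rfl⟩ | ⟨rfl, rfl, rfl⟩ |
      ⟨rfl, rfl, rfl⟩) <;> simp [hab, hbc, hac]

theorem card_rearrangements {a b c : Fin n} (hab : a ≤ b) (hbc : b ≤ c) :
    ({(a, b, c), (b, a, c), (a, c, b), (c, a, b), (b, c, a), (c, b, a)} :
      Finset (Triple n)).card = permCount (a, b, c) := by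
  rcases hab.eq_or_lt with rfl | h1 <;> rcases hbc.eq_or_lt with rfl | h2
  · simp [permCount]
  · simp [permCount, h2.ne, h2.ne']
  · simp [permCount, h1.ne, h1.ne']
  · simp [permCount, h1.ne, h1.ne', h2.ne, h2.ne', (h1.trans h2).ne,
      (h1.trans h2).ne']

theorem sum_permCount :
    ∑ u : Triple n with IsNormal u, permCount u = Fintype.card (Triple n) := by
  rw [← Finset.card_univ, Finset.card_eq_sum_card_fiberwise (f := sort)
    (t := Finset.univ.filter IsNormal) (fun w _ => by simpa using isNormal_sort w)]
  refine Finset.sum_congr rfl fun u hu => ?_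
  obtain ⟨a, b, c⟩ := u
  obtain ⟨hab, hbc⟩ := (Finset.mem_filter.1 hu).2
  rw [← card_rearrangements hab hbc]
  congr 1
  ext w
  simp only [Finset.mem_filter, Finset.mem_univ, true_and]
  exact (sort_eq_iff hab hbc w).symm

end Triple

/-! ### Small orbits of two involutions -/

section Dihedral

variable {α : Type*} [DecidableEq α] {s t : α → α} {Y : Finset α}

/-- The hypotheses make `w, s w, t w, t s w, s t w, s t s w` distinct. If they exhaust `Y`, then `t
s t w` is among them and can only be `s t s w`. -/
theorem six_le_card_of_involutive (hs : ∀ x, s (s x) = x) (ht : ∀ x, t (t x) = x)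
    (hsY : ∀ x ∈ Y, s x ∈ Y) (htY : ∀ x ∈ Y, t x ∈ Y) (h1 : ∀ x ∈ Y, s x ≠ x)
    (h2 : ∀ x ∈ Y, t x ≠ x) (h3 : ∀ x ∈ Y, s x ≠ t x) (h4 : ∀ x ∈ Y, s (t x) ≠ t (s x)) {w : α}
    (hw : w ∈ Y) : 6 ≤ Y.card ∧ (Y.card = 6 → s (t (s w)) = t (s (t w))) := by
  have a1 := hsY w hw
  have a2 := htY w hw
  have a3 := htY _ a1
  have a4 := hsY _ a2
  have a5 := hsY _ a3
  have a6 := htY _ a4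
  have hcard : ({w, s w, t w, t (s w), s (t w), s (t (s w))} : Finset α).card = 6 := by
    repeat rw [Finset.card_insert_of_notMem]
    · simp
    all_goals simp only [Finset.mem_insert, Finset.mem_singleton]; grind
  have hsub : ({w, s w, t w, t (s w), s (t w), s (t (s w))} : Finset α) ⊆ Y := by
    intro x hx
    simp only [Finset.mem_insert, Finset.mem_singleton] at hx
    rcases hx with rfl | rfl | rfl | rfl | rfl | rfl <;> assumption
  refine ⟨hcard ▸ Finset.card_le_card hsub, fun h => ?_⟩
  rw [← Finset.eq_of_subset_of_card_le hsub (by omega)] at a6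
  simp only [Finset.mem_insert, Finset.mem_singleton] at a6
  grind

/-- The orbit is a path starting at the fixed point `u` of `s`. With only three points, `t` must fix
the other end `s t u`, and the braid relation can be checked pointwise. -/
theorem three_le_card_of_involutive (hs : ∀ x, s (s x) = x) (ht : ∀ x, t (t x) = x)
    (hsY : ∀ x ∈ Y, s x ∈ Y) (htY : ∀ x ∈ Y, t x ∈ Y) {u : α} (hu : u ∈ Y) (h1 : s u = u)
    (h2 : t u ≠ u) (h3 : s (t u) ≠ t u) :
    3 ≤ Y.card ∧ (Y.card = 3 → ∀ w ∈ Y, s (t (s w)) = t (s (t w))) := by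
  have a2 := htY u hu
  have a4 := hsY _ a2
  have a6 := htY _ a4
  have hcard : ({u, t u, s (t u)} : Finset α).card = 3 := by
    repeat rw [Finset.card_insert_of_notMem]
    · simp
    all_goals simp only [Finset.mem_insert, Finset.mem_singleton]; grind
  have hsub : ({u, t u, s (t u)} : Finset α) ⊆ Y := by
    intro x hx
    simp only [Finset.mem_insert, Finset.mem_singleton] at hx
    rcases hx with rfl | rfl | rfl <;> assumption
  refine ⟨hcard ▸ Finset.card_le_card hsub, fun h w hw => ?_⟩
  rw [← Finset.eq_of_subset_of_card_le hsub (by omega)] at a6 hw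
  simp only [Finset.mem_insert, Finset.mem_singleton] at a6 hw
  grind

end Dihedral

/-! ### Sizes of the fibres and the braid relation -/

namespace TripleNormalForm

open Triple

variable {n : ℕ} {r : SkewInvolution n} (N : TripleNormalForm r)

/-- The words with normal form `u`. -/
def orbit (u : Triple n) : Finset (Triple n) := Finset.univ.filter fun w => N.nf w = u

theorem mem_orbit {u w : Triple n} : w ∈ N.orbit u ↔ N.nf w = u := by simp [orbit]

theorem left_mem_orbit {u : Triple n} : ∀ w ∈ N.orbit u, r.left w ∈ N.orbit u := fun w hw => by
  rwa [mem_orbit, N.nf_left, ← mem_orbit]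

theorem right_mem_orbit {u : Triple n} : ∀ w ∈ N.orbit u, r.right w ∈ N.orbit u := fun w hw => by
  rwa [mem_orbit, N.nf_right, ← mem_orbit]

theorem self_mem_orbit {u : Triple n} (hu : IsNormal u) : u ∈ N.orbit u :=
  N.mem_orbit.2 (N.nf_eq u hu)

theorem sum_card_orbit :
    ∑ u : Triple n with IsNormal u, (N.orbit u).card = Fintype.card (Triple n) := by
  rw [← Finset.card_univ, Finset.card_eq_sum_card_fiberwise (f := N.nf)
    (t := Finset.univ.filter IsNormal) (fun w _ => by simpa using N.isNormal_nf w)]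
  rfl

theorem _root_.SkewInvolution.left_eq_iff (r : SkewInvolution n) (w : Triple n) :
    r.left w = w ↔ w.1 = w.2.1 := by
  obtain ⟨x, y, z⟩ := w
  constructor
  · intro h
    exact r.map_fst_eq_iff.1 (congrArg Prod.fst h)
  · intro h
    simp only at h
    subst h
    simp [SkewInvolution.left, r.map_diag]

theorem _root_.SkewInvolution.right_eq_iff (r : SkewInvolution n) (w : Triple n) :
    r.right w = w ↔ w.2.1 = w.2.2 := by
  obtain ⟨x, y, z⟩ := w
  constructor
  · intro h
    exact r.map_fst_eq_iff.1 (congrArg (fun w : Triple n => w.2.1) h)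
  · intro h
    simp only at h
    subst h
    simp [SkewInvolution.right, r.map_diag]

/-- Words `xxy` and `xyy` with `x ≠ y` are in `Repeats`, and `xxx` is its own normal form; none has
a normal form of height `-2`. -/
theorem ne_of_strict {a b c : Fin n} (hab : a < b) (hbc : b < c) {w : Triple n}
    (hw : w ∈ N.orbit (a, b, c)) : w.1 ≠ w.2.1 ∧ w.2.1 ≠ w.2.2 := by
  have hh : height (N.nf w) = -2 := by
    rw [N.mem_orbit.1 hw]
    simp [height, pairSign_asc hab, pairSign_asc hbc]
  obtain ⟨x, y, z⟩ := w
  have h1 : ¬ N.Repeats (x, y, z) := fun h => by rw [Repeats, hh] at h; omega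
  have h2 : x = y → y = z → False := by
    rintro rfl rfl
    rw [N.nf_eq _ ⟨le_rfl, le_rfl⟩] at hh
    simp [height, pairSign_diag] at hh
  constructor
  · rintro h : x = y
    subst h
    exact h1 (N.repeats_aab (h2 rfl))
  · rintro h : y = z
    subst h
    exact h1 (N.repeats_abb fun h => h2 h rfl)

theorem orbit_strict {a b c : Fin n} (hab : a < b) (hbc : b < c) {w : Triple n}
    (hw : w ∈ N.orbit (a, b, c)) : 6 ≤ (N.orbit (a, b, c)).card ∧
      ((N.orbit (a, b, c)).card = 6 →
        r.left (r.right (r.left w)) = r.right (r.left (r.right w))) := by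
  refine six_le_card_of_involutive r.left_left r.right_right N.left_mem_orbit N.right_mem_orbit
    (fun v hv h => ?_) (fun v hv h => ?_) (fun v hv h => ?_) (fun v hv h => ?_) hw
  · exact (N.ne_of_strict hab hbc hv).1 ((r.left_eq_iff v).1 h)
  · exact (N.ne_of_strict hab hbc hv).2 ((r.right_eq_iff v).1 h)
  · exact (N.ne_of_strict hab hbc hv).1 (r.map_fst_eq_iff.1 (congrArg Prod.fst h))
  -- If the two moves commuted at `v`, comparing first letters and cancelling by left nondegeneracy
  -- would make the last two letters equal.
  · have h0 : (r.map (v.1, (r.map v.2).1)).1 = (r.map (v.1, v.2.1)).1 :=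
      congrArg (fun w : Triple n => w.1) h
    have h1 := N.map_fst_injective h0
    exact (N.ne_of_strict hab hbc hv).2 (r.map_fst_eq_iff.1 h1)

theorem orbit_aab {a b : Fin n} (hab : a < b) : 3 ≤ (N.orbit (a, a, b)).card ∧
    ((N.orbit (a, a, b)).card = 3 → ∀ w ∈ N.orbit (a, a, b),
      r.left (r.right (r.left w)) = r.right (r.left (r.right w))) := by
  refine three_le_card_of_involutive r.left_left r.right_right N.left_mem_orbit N.right_mem_orbit
    (N.self_mem_orbit ⟨le_rfl, hab.le⟩) ((r.left_eq_iff _).2 rfl) (fun h => ?_) (fun h => ?_)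
  · exact hab.ne ((r.right_eq_iff _).1 h)
  · have h1 := (r.left_eq_iff _).1 h
    exact hab.ne (r.map_fst_eq_iff.1 h1.symm)

theorem orbit_abb {a b : Fin n} (hab : a < b) : 3 ≤ (N.orbit (a, b, b)).card ∧
    ((N.orbit (a, b, b)).card = 3 → ∀ w ∈ N.orbit (a, b, b),
      r.right (r.left (r.right w)) = r.left (r.right (r.left w))) := by
  refine three_le_card_of_involutive r.right_right r.left_left N.right_mem_orbit N.left_mem_orbit
    (N.self_mem_orbit ⟨hab.le, le_rfl⟩) ((r.right_eq_iff _).2 rfl) (fun h => ?_) (fun h => ?_)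
  · exact hab.ne ((r.left_eq_iff _).1 h)
  · have h1 : (r.map (a, b)).2 = b := (r.right_eq_iff _).1 h
    have h2 := r.map_desc (a, b) hab
    rw [h1] at h2
    refine N.map_snd_ne b _ h2 ?_
    have e : ((r.map (a, b)).1, b) = r.map (a, b) := Prod.ext rfl h1.symm
    rw [e, r.map_map]

theorem permCount_le_card_orbit {u : Triple n} (hu : IsNormal u) :
    permCount u ≤ (N.orbit u).card := by
  obtain ⟨a, b, c⟩ := u
  obtain ⟨hab, hbc⟩ := id hu
  simp only at hab hbc
  rcases hab.eq_or_lt with rfl | h1 <;> rcases hbc.eq_or_lt with rfl | h2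
  · simp only [permCount, if_true]
    exact Finset.card_pos.2 ⟨_, N.self_mem_orbit hu⟩
  · simpa [permCount, h2.ne] using (N.orbit_aab h2).1
  · simpa [permCount, h1.ne] using (N.orbit_abb h1).1
  · simpa [permCount, h1.ne, h2.ne] using (N.orbit_strict h1 h2 (N.self_mem_orbit hu)).1

/-- The lower bounds and the cardinalities have the same sum `n ^ 3`, so every bound is attained. -/
theorem card_orbit {u : Triple n} (hu : IsNormal u) : (N.orbit u).card = permCount u := by
  have h : ∑ u : Triple n with IsNormal u, permCount u
      = ∑ u : Triple n with IsNormal u, (N.orbit u).card := by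
    rw [sum_permCount, N.sum_card_orbit]
  exact ((Finset.sum_eq_sum_iff_of_le fun u hu =>
    N.permCount_le_card_orbit (Finset.mem_filter.1 hu).2).1 h u (by simpa using hu)).symm

/-- An involution of skew-polynomial type with a normal form on words of length three satisfies
the braid relation. -/
theorem braid (N : TripleNormalForm r) (w : Triple n) : r.left (r.right (r.left w)) = r.right (r.left (r.right w)) := by
  have hu := N.isNormal_nf w
  have hw : w ∈ N.orbit (N.nf w) := N.mem_orbit.2 rfl
  have hcard := N.card_orbit hu
  generalize N.nf w = u at *
  obtain ⟨a, b, c⟩ := u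
  obtain ⟨hab, hbc⟩ := id hu
  simp only at hab hbc
  rcases hab.eq_or_lt with rfl | h1 <;> rcases hbc.eq_or_lt with rfl | h2
  · simp only [permCount, if_true] at hcard
    obtain ⟨v, hv⟩ := Finset.card_eq_one.1 hcard
    have hs : ∀ w ∈ N.orbit (a, a, a), w = v := fun w hw => by simpa [hv] using hw
    rw [hs _ (N.left_mem_orbit _ (N.right_mem_orbit _ (N.left_mem_orbit _ hw))),
      hs _ (N.right_mem_orbit _ (N.left_mem_orbit _ (N.right_mem_orbit _ hw)))]
  · simp only [permCount, h2.ne, if_true, if_false] at hcard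
    exact (N.orbit_aab h2).2 hcard w hw
  · simp only [permCount, h1.ne, if_true, if_false] at hcard
    exact ((N.orbit_abb h1).2 hcard w hw).symm
  · simp only [permCount, h1.ne, h2.ne, if_false] at hcard
    exact (N.orbit_strict h1 h2 hw).2 hcard

end TripleNormalForm

/-! ### Scalars and the Yang-Baxter equation on basis words -/

/-- A normal form for words of length three up to scalars, where `κ q` is the scalar by which the
pair `q` is multiplied when it is replaced by `r.map q`. -/
structure ScalarNormalForm {k : Type*} [Field k] {n : ℕ} (r : SkewInvolution n)
    (κ : Fin n × Fin n → k) extends TripleNormalForm r where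
  /-- the scalar relating a word to its normal form -/
  scalar : Triple n → k
  scalar_ne_zero : ∀ w, scalar w ≠ 0
  scalar_eq_one : ∀ w : Triple n, w.IsNormal → scalar w = 1
  scalar_left : ∀ w, scalar w = κ (w.1, w.2.1) * scalar (r.left w)
  scalar_right : ∀ w, scalar w = κ w.2 * scalar (r.right w)

/-- Induction along the replacement of descents. -/
theorem SkewInvolution.triple_induction {n : ℕ} (r : SkewInvolution n) {P : Triple n → Prop}
    (normal : ∀ w, w.IsNormal → P w)
    (left : ∀ w : Triple n, w.2.1 < w.1 → P (r.left w) → P w)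
    (right : ∀ w : Triple n, w.2.2 < w.2.1 → P (r.right w) → P w) (w : Triple n) : P w := by
  -- The measure orders the first two letters lexicographically: `left` at a descent lowers the
  -- first letter and the new second letter stays below `n`; `right` keeps the first letter and
  -- lowers the second.
  induction hm : (w.1 : ℕ) * n + (w.2.1 : ℕ) using Nat.strong_induction_on generalizing w with
  | _ m ih =>
    subst hm
    by_cases h1 : w.2.1 < w.1
    · refine left w h1 (ih _ ?_ _ rfl)
      have h2 : (r.map (w.1, w.2.1)).1 < w.1 := r.map_fst_lt (w.1, w.2.1) h1
      have h3 : ((r.map (w.1, w.2.1)).1 : ℕ) + 1 ≤ (w.1 : ℕ) := h2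
      have h4 := (r.map (w.1, w.2.1)).2.isLt
      have h5 := Nat.mul_le_mul_right n h3
      change ((r.map (w.1, w.2.1)).1 : ℕ) * n + ((r.map (w.1, w.2.1)).2 : ℕ) < _
      rw [add_mul, one_mul] at h5
      omega
    · by_cases h2 : w.2.2 < w.2.1
      · refine right w h2 (ih _ ?_ _ rfl)
        have h3 : ((r.map w.2).1 : ℕ) < (w.2.1 : ℕ) := r.map_fst_lt w.2 h2
        change (w.1 : ℕ) * n + ((r.map w.2).1 : ℕ) < _
        omega
      · exact normal w ⟨not_lt.1 h1, not_lt.1 h2⟩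

namespace SkewPolynomialRelations

variable {k : Type*} [Field k] {n : ℕ} (S : SkewPolynomialRelations k n)

theorem lhs_rhs (p : DescPair n) : S.lhs (S.rhs_lt p) = p := S.lhs_eq _ p rfl

/-- The permutation of words of length two underlying `R(ℜ₀)`, as a function. -/
noncomputable def pairMap (q : Fin n × Fin n) : Fin n × Fin n :=
  if h : q.2 < q.1 then S.rhs ⟨q, h⟩ else if h' : q.1 < q.2 then (S.lhs h').1 else q

/-- The scalars in the definition of `R(ℜ₀)`. -/
noncomputable def pairScalar (q : Fin n × Fin n) : k :=
  if h : q.2 < q.1 then S.coeff ⟨q, h⟩ else if h' : q.1 < q.2 then (S.coeff (S.lhs h'))⁻¹ else 1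

theorem pairMap_desc (p : DescPair n) : S.pairMap p.1 = S.rhs p := dif_pos p.2

theorem pairMap_asc (p : DescPair n) : S.pairMap (S.rhs p) = p.1 := by
  rw [pairMap, dif_neg (S.rhs_lt p).not_gt, dif_pos (S.rhs_lt p), S.lhs_rhs]

theorem pairScalar_desc (p : DescPair n) : S.pairScalar p.1 = S.coeff p := dif_pos p.2

theorem pairScalar_asc (p : DescPair n) : S.pairScalar (S.rhs p) = (S.coeff p)⁻¹ := by
  rw [pairScalar, dif_neg (S.rhs_lt p).not_gt, dif_pos (S.rhs_lt p), S.lhs_rhs]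

theorem pairMap_diag (x : Fin n) : S.pairMap (x, x) = (x, x) := by simp [pairMap]

theorem pairScalar_diag (x : Fin n) : S.pairScalar (x, x) = 1 := by simp [pairScalar]

theorem pair_cases {P : Fin n × Fin n → Prop} (desc : ∀ p : DescPair n, P p.1)
    (asc : ∀ p, P (S.rhs p)) (diag : ∀ x, P (x, x)) (q : Fin n × Fin n) : P q := by
  obtain ⟨x, y⟩ := q
  rcases lt_trichotomy x y with h | rfl | h
  · rw [← S.rhs_lhs h]; exact asc _
  · exact diag _
  · exact desc ⟨(x, y), h⟩

/-- The permutation of words of length two underlying `R(ℜ₀)`. -/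
noncomputable def skewInvolution : SkewInvolution n where
  map := S.pairMap
  map_map := S.pair_cases (fun p => by rw [pairMap_desc, pairMap_asc])
    (fun p => by rw [pairMap_asc, pairMap_desc]) fun x => by rw [pairMap_diag, pairMap_diag]
  map_diag := S.pairMap_diag
  map_asc q h := by rw [S.pairMap_desc ⟨q, h⟩]; exact S.rhs_lt _
  map_desc q h := by
    have := S.pairMap_asc (S.lhs h)
    rw [S.rhs_lhs h] at this
    rw [show q = (q.1, q.2) from rfl, this]
    exact (S.lhs h).2
  map_fst_lt q h := by rw [S.pairMap_desc ⟨q, h⟩]; exact S.rhs_fst_lt ⟨q, h⟩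

theorem pairScalar_ne_zero (q : Fin n × Fin n) : S.pairScalar q ≠ 0 :=
  S.pair_cases (P := fun q => S.pairScalar q ≠ 0)
    (fun p => by rw [pairScalar_desc]; exact S.coeff_ne_zero p)
    (fun p => by rw [pairScalar_asc]; exact inv_ne_zero (S.coeff_ne_zero p))
    (fun x => by rw [pairScalar_diag]; exact one_ne_zero) q

theorem pairScalar_mul_map (q : Fin n × Fin n) :
    S.pairScalar q * S.pairScalar (S.pairMap q) = 1 :=
  S.pair_cases (P := fun q => S.pairScalar q * S.pairScalar (S.pairMap q) = 1)
    (fun p => by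
      rw [pairMap_desc, pairScalar_desc, pairScalar_asc, mul_inv_cancel₀ (S.coeff_ne_zero p)])
    (fun p => by
      rw [pairMap_asc, pairScalar_desc, pairScalar_asc, inv_mul_cancel₀ (S.coeff_ne_zero p)])
    (fun x => by rw [pairMap_diag, pairScalar_diag, one_mul]) q

section Tensor

variable {V : Type*} [AddCommGroup V] [Module k V] (b : Module.Basis (Fin n) k V)

theorem automorphism_tmul (q : Fin n × Fin n) : S.automorphism b (b q.1 ⊗ₜ[k] b q.2)
    = S.pairScalar q • (b (S.pairMap q).1 ⊗ₜ[k] b (S.pairMap q).2) := by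
  change S.autoMap b _ = _
  refine S.pair_cases (P := fun q => S.autoMap b (b q.1 ⊗ₜ[k] b q.2)
    = S.pairScalar q • (b (S.pairMap q).1 ⊗ₜ[k] b (S.pairMap q).2)) (fun p => ?_) (fun p => ?_)
    (fun x => ?_) q
  · rw [autoMap_desc, pairMap_desc, pairScalar_desc]
  · rw [autoMap_asc, pairMap_asc, pairScalar_asc]
  · rw [autoMap_diag, pairMap_diag, pairScalar_diag, one_smul]

/-- The basis of `(V ⊗ V) ⊗ V` indexed by words of length three. -/
noncomputable def tripleBasis {V : Type*} [AddCommGroup V] [Module k V]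
    (b : Module.Basis (Fin n) k V) : Module.Basis (Triple n) k ((V ⊗[k] V) ⊗[k] V) :=
  ((b.tensorProduct b).tensorProduct b).reindex (Equiv.prodAssoc _ _ _)

theorem tripleBasis_apply (w : Triple n) :
    tripleBasis b w = (b w.1 ⊗ₜ[k] b w.2.1) ⊗ₜ[k] b w.2.2 := by
  simp [tripleBasis, Module.Basis.tensorProduct_apply]

theorem actLeft_tripleBasis (w : Triple n) : actLeft (S.automorphism b) (tripleBasis b w)
    = S.pairScalar (w.1, w.2.1) • tripleBasis b (S.skewInvolution.left w) := by
  rw [tripleBasis_apply, tripleBasis_apply, actLeft, TensorProduct.congr_tmul,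
    S.automorphism_tmul b (w.1, w.2.1), LinearEquiv.refl_apply, TensorProduct.smul_tmul']
  rfl

theorem actRight_tripleBasis (w : Triple n) : actRight (S.automorphism b) (tripleBasis b w)
    = S.pairScalar w.2 • tripleBasis b (S.skewInvolution.right w) := by
  rw [tripleBasis_apply, tripleBasis_apply, actRight, LinearEquiv.trans_apply,
    LinearEquiv.trans_apply, TensorProduct.assoc_tmul, TensorProduct.congr_tmul,
    S.automorphism_tmul b w.2, LinearEquiv.refl_apply, TensorProduct.tmul_smul, map_smul,
    TensorProduct.assoc_symm_tmul]
  rfl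

theorem isYangBaxterSolution_iff : IsYangBaxterSolution (S.automorphism b) ↔
    ∀ w, S.skewInvolution.left (S.skewInvolution.right (S.skewInvolution.left w))
        = S.skewInvolution.right (S.skewInvolution.left (S.skewInvolution.right w)) ∧
      S.pairScalar (w.1, w.2.1) * S.pairScalar (S.skewInvolution.left w).2
          * S.pairScalar ((S.skewInvolution.right (S.skewInvolution.left w)).1,
            (S.skewInvolution.right (S.skewInvolution.left w)).2.1)
        = S.pairScalar w.2 * S.pairScalar ((S.skewInvolution.right w).1,
            (S.skewInvolution.right w).2.1)
          * S.pairScalar (S.skewInvolution.left (S.skewInvolution.right w)).2 := by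
  have h1 : ∀ w, (actLeft (S.automorphism b) * actRight (S.automorphism b)
      * actLeft (S.automorphism b)) (tripleBasis b w)
      = (S.pairScalar (w.1, w.2.1) * S.pairScalar (S.skewInvolution.left w).2
          * S.pairScalar ((S.skewInvolution.right (S.skewInvolution.left w)).1,
            (S.skewInvolution.right (S.skewInvolution.left w)).2.1)) • tripleBasis b
        (S.skewInvolution.left (S.skewInvolution.right (S.skewInvolution.left w))) := fun w => by
    simp only [LinearEquiv.mul_apply, actLeft_tripleBasis, actRight_tripleBasis, map_smul, smul_smul,
      mul_assoc]
  have h2 : ∀ w, (actRight (S.automorphism b) * actLeft (S.automorphism b)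
      * actRight (S.automorphism b)) (tripleBasis b w)
      = (S.pairScalar w.2 * S.pairScalar ((S.skewInvolution.right w).1,
            (S.skewInvolution.right w).2.1)
          * S.pairScalar (S.skewInvolution.left (S.skewInvolution.right w)).2) • tripleBasis b
        (S.skewInvolution.right (S.skewInvolution.left (S.skewInvolution.right w))) := fun w => by
    simp only [LinearEquiv.mul_apply, actLeft_tripleBasis, actRight_tripleBasis, map_smul, smul_smul,
      mul_assoc]
  constructor
  · intro h w
    have h3 := congrArg (fun f : ((V ⊗[k] V) ⊗[k] V) ≃ₗ[k] ((V ⊗[k] V) ⊗[k] V) =>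
      (tripleBasis b).repr (f (tripleBasis b w))) h
    simp only [h1, h2, map_smul, Module.Basis.repr_self, Finsupp.smul_single, smul_eq_mul,
      mul_one] at h3
    rcases (Finsupp.single_eq_single_iff _ _ _ _).1 h3 with h4 | h4
    · exact h4
    · exact absurd h4.1 (mul_ne_zero (mul_ne_zero (S.pairScalar_ne_zero _)
        (S.pairScalar_ne_zero _)) (S.pairScalar_ne_zero _))
  · intro h
    refine LinearEquiv.toLinearMap_injective ((tripleBasis b).ext fun w => ?_)
    rw [LinearEquiv.coe_coe, LinearEquiv.coe_coe, h1, h2, (h w).1, (h w).2]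

/-- Both sides of the braid relation lead from `w` to the same word. Following `scalar` along either
path gives `scalar w` as the product of the factors times the nonzero scalar of that end word, which
cancels. -/
theorem isYangBaxterSolution_of_scalarNormalForm
    (N : ScalarNormalForm S.skewInvolution S.pairScalar) :
    IsYangBaxterSolution (S.automorphism b) := by
  refine (S.isYangBaxterSolution_iff b).2 fun w => ?_
  have hb := N.braid w
  refine ⟨hb, ?_⟩
  have h1 : N.scalar w = _ := (N.scalar_left w).trans (congrArg _
    ((N.scalar_right _).trans (congrArg _ (N.scalar_left _))))
  have h2 : N.scalar w = _ := (N.scalar_right w).trans (congrArg _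
    ((N.scalar_left _).trans (congrArg _ (N.scalar_right _))))
  rw [← hb] at h2
  refine mul_right_cancel₀ (N.scalar_ne_zero
    (S.skewInvolution.left (S.skewInvolution.right (S.skewInvolution.left w)))) ?_
  linear_combination h2 - h1

end Tensor

end SkewPolynomialRelations

/-! ### From the Yang-Baxter equation to normal forms -/

namespace SkewPolynomialRelations

open Triple

variable {k : Type*} [Field k] {n : ℕ} (S : SkewPolynomialRelations k n)

/-- `R(ℜ₀) ⊗ id` on scalar multiples of words of length three. -/
noncomputable def termLeft (p : k × Triple n) : k × Triple n :=
  (p.1 * S.pairScalar (p.2.1, p.2.2.1), S.skewInvolution.left p.2)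

/-- `id ⊗ R(ℜ₀)` on scalar multiples of words of length three. -/
noncomputable def termRight (p : k × Triple n) : k × Triple n :=
  (p.1 * S.pairScalar p.2.2, S.skewInvolution.right p.2)

theorem termLeft_termLeft (p : k × Triple n) : S.termLeft (S.termLeft p) = p := by
  refine Prod.ext ?_ (S.skewInvolution.left_left _)
  change p.1 * S.pairScalar (p.2.1, p.2.2.1) * S.pairScalar (S.pairMap (p.2.1, p.2.2.1)) = p.1
  rw [mul_assoc, S.pairScalar_mul_map, mul_one]

theorem termRight_termRight (p : k × Triple n) : S.termRight (S.termRight p) = p := by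
  refine Prod.ext ?_ (S.skewInvolution.right_right _)
  change p.1 * S.pairScalar p.2.2 * S.pairScalar (S.pairMap p.2.2) = p.1
  rw [mul_assoc, S.pairScalar_mul_map, mul_one]

theorem termLeft_eq_self {p : k × Triple n} (h : p.2.1 = p.2.2.1) : S.termLeft p = p := by
  refine Prod.ext ?_ ((S.skewInvolution.left_eq_iff _).2 h)
  simp only [termLeft, h, S.pairScalar_diag, mul_one]

theorem termRight_eq_self {p : k × Triple n} (h : p.2.2.1 = p.2.2.2) : S.termRight p = p := by
  refine Prod.ext ?_ ((S.skewInvolution.right_eq_iff _).2 h)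
  change p.1 * S.pairScalar (p.2.2.1, p.2.2.2) = p.1
  rw [h, S.pairScalar_diag, mul_one]

/-- The braid relation for the action on scalar multiples of words. -/
def TermBraid : Prop :=
  ∀ p, S.termLeft (S.termRight (S.termLeft p)) = S.termRight (S.termLeft (S.termRight p))

theorem termBraid_of_isYangBaxterSolution {V : Type*} [AddCommGroup V] [Module k V]
    (b : Module.Basis (Fin n) k V) (h : IsYangBaxterSolution (S.automorphism b)) :
    S.TermBraid := by
  rintro ⟨c, w⟩
  obtain ⟨h1, h2⟩ := (S.isYangBaxterSolution_iff b).1 h w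
  refine Prod.ext ?_ h1
  simp only [termLeft, termRight]
  linear_combination c * h2

open Classical in
/-- The orbit of a word under the group generated by `termLeft` and `termRight`. -/
noncomputable def termOrbit (u : Triple n) : Finset (k × Triple n) :=
  {(1, u), S.termLeft (1, u), S.termRight (1, u), S.termRight (S.termLeft (1, u)),
    S.termLeft (S.termRight (1, u)), S.termLeft (S.termRight (S.termLeft (1, u)))}

theorem self_mem_termOrbit (u : Triple n) : ((1 : k), u) ∈ S.termOrbit u := by
  simp [termOrbit]

theorem termLeft_mem_termOrbit {u : Triple n} {p : k × Triple n} (hp : p ∈ S.termOrbit u) :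
    S.termLeft p ∈ S.termOrbit u := by
  simp only [termOrbit, Finset.mem_insert, Finset.mem_singleton] at hp ⊢
  rcases hp with rfl | rfl | rfl | rfl | rfl | rfl <;> simp [termLeft_termLeft]

theorem termRight_mem_termOrbit (hS : S.TermBraid) {u : Triple n} {p : k × Triple n}
    (hp : p ∈ S.termOrbit u) : S.termRight p ∈ S.termOrbit u := by
  simp only [termOrbit, Finset.mem_insert, Finset.mem_singleton] at hp ⊢
  rcases hp with rfl | rfl | rfl | rfl | rfl | rfl
  · simp
  · simp
  · simp [termRight_termRight]
  · simp [termRight_termRight]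
  · rw [← hS]; simp
  · rw [hS, termRight_termRight]; simp

/-- A repeated adjacent letter in `u` makes `(1, u)` a fixed point of the corresponding move, which
collapses the six listed elements to three, or to one if both moves fix it. -/
theorem card_termOrbit_le (hS : S.TermBraid) {u : Triple n} :
    (S.termOrbit u).card ≤ permCount u := by
  classical
  by_cases h1 : u.1 = u.2.1
  · have e1 : S.termLeft (1, u) = (1, u) := S.termLeft_eq_self h1
    by_cases h2 : u.2.1 = u.2.2
    · have e2 : S.termRight (1, u) = (1, u) := S.termRight_eq_self h2
      simp [termOrbit, permCount, h1, h2, e1, e2]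
    · have hsub : S.termOrbit u
          ⊆ {(1, u), S.termRight (1, u), S.termLeft (S.termRight (1, u))} := by
        simp [termOrbit, e1]
      rw [permCount, if_pos h1, if_neg h2]
      exact (Finset.card_le_card hsub).trans Finset.card_le_three
  · by_cases h2 : u.2.1 = u.2.2
    · have e2 : S.termRight (1, u) = (1, u) := S.termRight_eq_self h2
      have hsub : S.termOrbit u
          ⊆ {(1, u), S.termLeft (1, u), S.termRight (S.termLeft (1, u))} := by
        simp [termOrbit, hS (1, u), e2]
      rw [permCount, if_neg h1, if_pos h2]
      exact (Finset.card_le_card hsub).trans Finset.card_le_three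
    · rw [permCount, if_neg h1, if_neg h2]
      exact Finset.card_le_six

theorem fst_ne_zero_of_mem_termOrbit {u : Triple n} {p : k × Triple n} (hp : p ∈ S.termOrbit u) :
    p.1 ≠ 0 := by
  have h1 : ∀ p : k × Triple n, p.1 ≠ 0 → (S.termLeft p).1 ≠ 0 := fun p hp =>
    mul_ne_zero hp (S.pairScalar_ne_zero _)
  have h2 : ∀ p : k × Triple n, p.1 ≠ 0 → (S.termRight p).1 ≠ 0 := fun p hp =>
    mul_ne_zero hp (S.pairScalar_ne_zero _)
  have h0 : ((1 : k), u).1 ≠ 0 := one_ne_zero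
  simp only [termOrbit, Finset.mem_insert, Finset.mem_singleton] at hp
  rcases hp with rfl | rfl | rfl | rfl | rfl | rfl
  · exact h0
  · exact h1 _ h0
  · exact h2 _ h0
  · exact h2 _ (h1 _ h0)
  · exact h1 _ (h2 _ h0)
  · exact h1 _ (h2 _ (h1 _ h0))

theorem exists_mem_termOrbit (hS : S.TermBraid) (w : Triple n) :
    ∃ u, u.IsNormal ∧ ∃ c, (c, w) ∈ S.termOrbit u := by
  refine S.skewInvolution.triple_induction
    (P := fun w => ∃ u, u.IsNormal ∧ ∃ c, (c, w) ∈ S.termOrbit u) (fun w hw => ?_)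
    (fun w _ h => ?_) (fun w _ h => ?_) w
  · exact ⟨w, hw, 1, S.self_mem_termOrbit w⟩
  · obtain ⟨u, hu, c, hc⟩ := h
    have := S.termLeft_mem_termOrbit hc
    rw [termLeft, S.skewInvolution.left_left] at this
    exact ⟨u, hu, _, this⟩
  · obtain ⟨u, hu, c, hc⟩ := h
    have := S.termRight_mem_termOrbit hS hc
    rw [termRight, S.skewInvolution.right_right] at this
    exact ⟨u, hu, _, this⟩

/-- The orbits of normal words have total size at most `n ^ 3` and together cover all `n ^ 3` words,
so forgetting the scalar is injective on their disjoint union. -/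
theorem termOrbit_unique (hS : S.TermBraid) {w u u' : Triple n} {c c' : k} (hu : u.IsNormal)
    (hu' : u'.IsNormal) (h : (c, w) ∈ S.termOrbit u) (h' : (c', w) ∈ S.termOrbit u') :
    u = u' ∧ c = c' := by
  classical
  obtain ⟨A, hA⟩ : ∃ A : Finset (Σ _ : Triple n, k × Triple n),
      A = (Finset.univ.filter IsNormal).sigma fun u => S.termOrbit u := ⟨_, rfl⟩
  have hmem : ∀ u c w, u.IsNormal → (c, w) ∈ S.termOrbit u →
      (⟨u, c, w⟩ : Σ _ : Triple n, k × Triple n) ∈ A := fun u c w hu h => by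
    rw [hA, Finset.mem_sigma, Finset.mem_filter]
    exact ⟨⟨Finset.mem_univ _, hu⟩, h⟩
  have himage : A.image (fun a => a.2.2) = Finset.univ := by
    refine Finset.eq_univ_of_forall fun w => ?_
    obtain ⟨u, hu, c, hc⟩ := S.exists_mem_termOrbit hS w
    exact Finset.mem_image.2 ⟨_, hmem u c w hu hc, rfl⟩
  have hcard : A.card ≤ (A.image fun a => a.2.2).card := by
    rw [himage, Finset.card_univ, ← sum_permCount, hA, Finset.card_sigma]
    exact Finset.sum_le_sum fun u _ => S.card_termOrbit_le hS
  have hinj := Finset.card_image_iff.1 (le_antisymm Finset.card_image_le hcard)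
  have := hinj (hmem u c w hu h) (hmem u' c' w hu' h') rfl
  simp only [Sigma.mk.injEq, heq_eq_eq, Prod.mk.injEq, and_true] at this
  exact this

theorem nonempty_scalarNormalForm_of_termBraid (hS : S.TermBraid) :
    Nonempty (ScalarNormalForm S.skewInvolution S.pairScalar) := by
  choose nf hnf c hc using S.exists_mem_termOrbit hS
  have hl : ∀ w, nf w = nf (S.skewInvolution.left w)
      ∧ c w * S.pairScalar (w.1, w.2.1) = c (S.skewInvolution.left w) := fun w =>
    S.termOrbit_unique hS (hnf _) (hnf _) (S.termLeft_mem_termOrbit (hc w)) (hc _)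
  have hr : ∀ w, nf w = nf (S.skewInvolution.right w)
      ∧ c w * S.pairScalar w.2 = c (S.skewInvolution.right w) := fun w =>
    S.termOrbit_unique hS (hnf _) (hnf _) (S.termRight_mem_termOrbit hS (hc w)) (hc _)
  have hn : ∀ w : Triple n, w.IsNormal → nf w = w ∧ c w = 1 := fun w hw =>
    S.termOrbit_unique hS (hnf _) hw (hc w) (S.self_mem_termOrbit w)
  exact ⟨{
    nf := nf
    nf_left := fun w => (hl w).1.symm
    nf_right := fun w => (hr w).1.symm
    isNormal_nf := hnf
    nf_eq := fun w hw => (hn w hw).1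
    -- Membership of `(c, w)` in the orbit of `(1, u)` identifies `c` times `w` with `u`, so the
    -- scalar in front of the normal form is the inverse.
    scalar := fun w => (c w)⁻¹
    scalar_ne_zero := fun w => inv_ne_zero (S.fst_ne_zero_of_mem_termOrbit (hc w))
    scalar_eq_one := fun w hw => by rw [(hn w hw).2, inv_one]
    scalar_left := fun w => by
      rw [← (hl w).2, mul_inv, mul_comm (c w)⁻¹, mul_inv_cancel_left₀ (S.pairScalar_ne_zero _)]
    scalar_right := fun w => by
      rw [← (hr w).2, mul_inv, mul_comm (c w)⁻¹, mul_inv_cancel_left₀ (S.pairScalar_ne_zero _)] }⟩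

end SkewPolynomialRelations

/-! ### Words and the diamond lemma -/

theorem List.Shortlex.trans_of_linearOrder {X : Type*} [LinearOrder X] {s t u : List X}
    (h1 : List.Shortlex (· < ·) s t) (h2 : List.Shortlex (· < ·) t u) :
    List.Shortlex (· < ·) s u := by
  rw [List.shortlex_def] at *
  rcases h1 with h1 | ⟨h1, h1'⟩ <;> rcases h2 with h2 | ⟨h2, h2'⟩
  · exact Or.inl (h1.trans h2)
  · exact Or.inl (h1.trans_eq h2)
  · exact Or.inl (h1.trans_lt h2)
  · exact Or.inr ⟨h1.trans h2, List.lt_trans (α := X) h1' h2'⟩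

theorem List.shortlex_append_cons_cons {X : Type*} [LinearOrder X] (p q : List X) {a x : X}
    (h : a < x) (b y : X) : List.Shortlex (· < ·) (p ++ a :: b :: q) (p ++ x :: y :: q) :=
  List.Shortlex.append_left (List.Shortlex.of_lex (by simp) (List.Lex.rel h)) p

/-- A locally confluent rewriting system, whose rules replace an object by a scalar multiple of a
smaller one, has normal forms. -/
theorem exists_normalForm_of_locally_confluent {k α M : Type*} [Field k] [AddCommGroup M]
    [Module k M] {lt : α → α → Prop} (wf : WellFounded lt) (step : α → α → k → Prop)
    (hlt : ∀ a b c, step a b c → lt b a) (base : α → M)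
    (confluent : ∀ (a : α) (F : α → M),
      (∀ a' b c, lt a' a → step a' b c → F a' = c • F b) →
      ∀ b c b' c', step a b c → step a b' c' → c • F b = c' • F b') :
    ∃ F : α → M, (∀ a b c, step a b c → F a = c • F b) ∧
      ∀ a, (∀ b c, ¬ step a b c) → F a = base a := by
  classical
  -- `F` is defined by well-founded recursion along an arbitrarily chosen step; confluence shows
  -- that the choice does not matter.
  let G : (a : α) → ((b : α) → lt b a → M) → M := fun a ih =>
    if h : ∃ d : α × k, step a d.1 d.2 then
      h.choose.2 • ih h.choose.1 (hlt _ _ _ h.choose_spec)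
    else base a
  have hG : ∀ a, wf.fix G a = G a fun b _ => wf.fix G b := fun a => wf.fix_eq G a
  refine ⟨wf.fix G, fun a => ?_, fun a ha => ?_⟩
  · induction a using wf.induction with
    | _ a ih =>
      intro b c hs
      have h : ∃ d : α × k, step a d.1 d.2 := ⟨(b, c), hs⟩
      rw [hG]
      simp only [G, dif_pos h]
      exact confluent a (wf.fix G) (fun a' b c hl hs => ih a' hl b c hs) _ _ _ _ h.choose_spec hs
  · rw [hG]
    exact dif_neg fun ⟨d, hd⟩ => ha _ _ hd

namespace SkewInvolution

variable {k : Type*} {n : ℕ} (r : SkewInvolution n) (κ : Fin n × Fin n → k)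

/-- Replacement of a descent in a word. -/
def Step (l l' : List (Fin n)) (c : k) : Prop :=
  ∃ p q x y, y < x ∧ l = p ++ x :: y :: q ∧
    l' = p ++ (r.map (x, y)).1 :: (r.map (x, y)).2 :: q ∧ c = κ (x, y)

variable {r κ}

theorem Step.shortlex {l l' : List (Fin n)} {c : k} (h : r.Step κ l l' c) :
    List.Shortlex (· < ·) l' l := by
  obtain ⟨p, q, x, y, hxy, rfl, rfl, -⟩ := h
  exact List.shortlex_append_cons_cons p q (r.map_fst_lt (x, y) hxy) _ _

theorem step_append {x y : Fin n} (h : y < x) (p q : List (Fin n)) :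
    r.Step κ (p ++ x :: y :: q) (p ++ (r.map (x, y)).1 :: (r.map (x, y)).2 :: q) (κ (x, y)) :=
  ⟨p, q, x, y, h, rfl, rfl, rfl⟩

variable [Field k]

/-- The list `t` measures the distance between the two descents. If empty, they coincide; if it has
one letter, they overlap in a word of length three, and both results reduce to its normal form with
the same scalar; if longer, they are disjoint and the replacements commute. -/
theorem confluent_of_prefix {M : Type*} [AddCommGroup M] [Module k M] (N : ScalarNormalForm r κ)
    {F : List (Fin n) → M} {p q p' q' : List (Fin n)} {x y x' y' : Fin n}
    (hF : ∀ a b c, List.Shortlex (· < ·) a (p ++ x :: y :: q) → r.Step κ a b c → F a = c • F b)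
    (hxy : y < x) (hxy' : y' < x') (h : p ++ x :: y :: q = p' ++ x' :: y' :: q')
    (t : List (Fin n)) (hp : p' = p ++ t) :
    κ (x, y) • F (p ++ (r.map (x, y)).1 :: (r.map (x, y)).2 :: q)
      = κ (x', y') • F (p' ++ (r.map (x', y')).1 :: (r.map (x', y')).2 :: q') := by
  subst hp
  rw [List.append_assoc, List.append_cancel_left_eq] at h
  rw [List.append_assoc]
  match t, h with
  | [], h =>
    simp only [List.nil_append, List.cons.injEq] at h
    obtain ⟨rfl, rfl, rfl⟩ := h
    rfl
  | [z], h =>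
    simp only [List.cons_append, List.nil_append, List.cons.injEq] at h
    obtain ⟨rfl, rfl, rfl⟩ := h
    have key : ∀ v : Triple n, List.Shortlex (· < ·) (p ++ v.1 :: v.2.1 :: v.2.2 :: q')
        (p ++ x :: y :: y' :: q') → F (p ++ v.1 :: v.2.1 :: v.2.2 :: q')
          = N.scalar v • F (p ++ (N.nf v).1 :: (N.nf v).2.1 :: (N.nf v).2.2 :: q') := by
      intro v
      refine r.triple_induction (P := fun v => List.Shortlex (· < ·)
        (p ++ v.1 :: v.2.1 :: v.2.2 :: q') (p ++ x :: y :: y' :: q') →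
          F (p ++ v.1 :: v.2.1 :: v.2.2 :: q')
          = N.scalar v • F (p ++ (N.nf v).1 :: (N.nf v).2.1 :: (N.nf v).2.2 :: q'))
        (fun v hv _ => ?_) (fun v hv ih hl => ?_) (fun v hv ih hl => ?_) v
      · rw [N.nf_eq v hv, N.scalar_eq_one v hv, one_smul]
      · have hs := step_append (r := r) (κ := κ) hv p (v.2.2 :: q')
        rw [hF _ _ _ hl hs, N.scalar_left v, mul_smul, ← N.nf_left v]
        exact congrArg _ (ih (hs.shortlex.trans_of_linearOrder hl))
      · have hs := step_append (r := r) (κ := κ) hv (p ++ [v.1]) q'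
        rw [List.append_assoc, List.append_assoc] at hs
        have e := hF _ _ _ hl hs
        have hl' := hs.shortlex.trans_of_linearOrder hl
        rw [N.scalar_right v, mul_smul, ← N.nf_right v]
        exact e.trans (congrArg _ (ih hl'))
    have h1 := step_append (r := r) (κ := κ) hxy p (y' :: q')
    have h2 := step_append (r := r) (κ := κ) hxy' (p ++ [x]) q'
    rw [List.append_assoc, List.append_assoc] at h2
    have e1 := key (r.left (x, y, y')) h1.shortlex
    have e2 := key (r.right (x, y, y')) h2.shortlex
    rw [N.nf_left] at e1
    rw [N.nf_right] at e2
    refine (congrArg _ e1).trans (Eq.trans ?_ (congrArg _ e2).symm)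
    rw [smul_smul, smul_smul]
    exact congrArg (· • _) ((N.scalar_left (x, y, y')).symm.trans (N.scalar_right (x, y, y')))
  | z :: z' :: t, h =>
    simp only [List.cons_append, List.cons.injEq] at h
    obtain ⟨rfl, rfl, rfl⟩ := h
    have h1 := step_append (r := r) (κ := κ) hxy p (t ++ x' :: y' :: q')
    have h2 := step_append (r := r) (κ := κ) hxy' (p ++ x :: y :: t) q'
    have h3 := step_append (r := r) (κ := κ) hxy p
      (t ++ (r.map (x', y')).1 :: (r.map (x', y')).2 :: q')
    have h4 := step_append (r := r) (κ := κ) hxy'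
      (p ++ (r.map (x, y)).1 :: (r.map (x, y)).2 :: t) q'
    simp only [List.append_assoc, List.cons_append] at h2 h4 ⊢
    rw [hF _ _ _ h1.shortlex h4, hF _ _ _ h2.shortlex h3, smul_comm]

/-- The diamond lemma for words of arbitrary length. -/
theorem exists_reduction (N : ScalarNormalForm r κ) :
    ∃ F : List (Fin n) → (List (Fin n) →₀ k), (∀ a b c, r.Step κ a b c → F a = c • F b) ∧
      ∀ a, (∀ b c, ¬ r.Step κ a b c) → F a = Finsupp.single a 1 := by
  refine exists_normalForm_of_locally_confluent (List.Shortlex.wf wellFounded_lt) (r.Step κ)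
    (fun _ _ _ h => h.shortlex) _ fun a F hF b c b' c' h h' => ?_
  obtain ⟨p, q, x, y, hxy, rfl, rfl, rfl⟩ := h
  obtain ⟨p', q', x', y', hxy', h, rfl, rfl⟩ := h'
  rcases List.append_eq_append_iff.1 h with ⟨t, ht, -⟩ | ⟨t, ht, -⟩
  · exact confluent_of_prefix N hF hxy hxy' h t ht
  · refine (confluent_of_prefix N (fun a b c ha => hF a b c ?_) hxy' hxy h.symm t ht).symm
    rwa [h]

/-- Reduction only lowers words, so smaller words cannot contribute to the coefficient of `u`. -/
theorem reduction_apply_eq_zero {F : List (Fin n) → (List (Fin n) →₀ k)}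
    (h1 : ∀ a b c, r.Step κ a b c → F a = c • F b)
    (h2 : ∀ a, (∀ b c, ¬ r.Step κ a b c) → F a = Finsupp.single a 1) (u v : List (Fin n))
    (h : List.Shortlex (· < ·) v u) : F v u = 0 := by
  induction v using (List.Shortlex.wf (α := Fin n) wellFounded_lt).induction with
  | _ v ih =>
    by_cases hv : ∃ b c, r.Step κ v b c
    · obtain ⟨b, c, hs⟩ := hv
      rw [h1 v b c hs, Finsupp.smul_apply, ih b hs.shortlex (hs.shortlex.trans_of_linearOrder h),
        smul_zero]
    · push Not at hv
      rw [h2 v hv, Finsupp.single_eq_of_ne]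
      rintro rfl
      exact asymm_of (List.Shortlex (· < ·)) h h

end SkewInvolution

/-! ### Words in the free algebra -/

namespace FreeAlgebra

variable {k X : Type*} [Field k]

/-- The monomial of the free algebra given by a word. -/
noncomputable def word (k : Type*) {X : Type*} [Field k] (l : List X) : FreeAlgebra k X :=
  (l.map (ι k)).prod

theorem word_append (l l' : List X) : word k (l ++ l') = word k l * word k l' := by
  simp [word]

theorem word_cons (x : X) (l : List X) : word k (x :: l) = ι k x * word k l := by
  simp [word]

theorem equiv_word (l : List X) : equivMonoidAlgebraFreeMonoid (word k l)
    = MonoidAlgebra.single (FreeMonoid.ofList l) 1 := by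
  induction l with
  | nil => simp [word]; rfl
  | cons x l ih =>
    rw [word_cons, map_mul, ih]
    have : equivMonoidAlgebraFreeMonoid (ι k x) = MonoidAlgebra.single (FreeMonoid.of x) 1 := by
      simp [equivMonoidAlgebraFreeMonoid]
    rw [this, MonoidAlgebra.single_mul_single, one_mul]
    rfl

/-- The basis of the free algebra that consists of the words. -/
noncomputable def wordBasis (k X : Type*) [Field k] :
    Module.Basis (List X) k (FreeAlgebra k X) :=
  (basisFreeMonoid k X).reindex FreeMonoid.toList

theorem wordBasis_repr_apply (f : FreeAlgebra k X) (l : List X) : (wordBasis k X).repr f l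
    = (equivMonoidAlgebraFreeMonoid f).coeff (FreeMonoid.ofList l) := by
  rw [wordBasis, Module.Basis.repr_reindex_apply]
  rfl

theorem wordBasis_apply (l : List X) : wordBasis k X l = word k l := by
  apply (wordBasis k X).repr.injective
  ext u
  rw [Module.Basis.repr_self, wordBasis_repr_apply, equiv_word, MonoidAlgebra.coeff_single]
  classical
  rw [Finsupp.single_apply, Finsupp.single_apply]
  simp only [EmbeddingLike.apply_eq_iff_eq]

end FreeAlgebra

theorem mem_wordSupport_iff {k X : Type*} [Field k] {f : FreeAlgebra k X} {w : List X} :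
    w ∈ wordSupport f ↔ (FreeAlgebra.wordBasis k X).repr f w ≠ 0 := by
  rw [FreeAlgebra.wordBasis_repr_apply]; rfl

theorem exists_isLeadingWord {k X : Type*} [Field k] [LinearOrder X] {f : FreeAlgebra k X}
    (hf : f ≠ 0) : ∃ u, IsLeadingWord f u := by
  classical
  set s := ((FreeAlgebra.wordBasis k X).repr f).support with hs
  have hm : ∀ w, w ∈ wordSupport f ↔ w ∈ s := fun w => by
    rw [mem_wordSupport_iff, hs, Finsupp.mem_support_iff]
  have key : ∀ s : Finset (List X), s.Nonempty →
      ∃ u ∈ s, ∀ v ∈ s, v ≠ u → List.Shortlex (· < ·) v u := by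
    intro s hs
    induction hs using Finset.Nonempty.cons_induction with
    | singleton a => exact ⟨a, by simp, by simp⟩
    | cons a s ha _ ih =>
      obtain ⟨u, hu, hmax⟩ := ih
      have hau : a ≠ u := fun h => ha (h ▸ hu)
      rcases trichotomous_of (List.Shortlex (· < ·)) a u with h | h | h
      · refine ⟨u, by simp [hu], fun v hv hvu => ?_⟩
        rcases Finset.mem_cons.1 hv with rfl | hv
        exacts [h, hmax v hv hvu]
      · exact absurd h hau
      · refine ⟨a, by simp, fun v hv hva => ?_⟩
        rcases Finset.mem_cons.1 hv with rfl | hv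
        · exact absurd rfl hva
        · by_cases hvu : v = u
          · rwa [hvu]
          · exact (hmax v hv hvu).trans_of_linearOrder h
  obtain ⟨u, hu, hmax⟩ := key s (by
    rw [Finsupp.support_nonempty_iff]
    simpa using hf)
  exact ⟨u, (hm u).2 hu, fun v hv => hmax v ((hm v).1 hv)⟩

theorem IsLeadingWord.eq {k X : Type*} [Field k] [LinearOrder X] {f : FreeAlgebra k X}
    {u v : List X} (hu : IsLeadingWord f u) (hv : IsLeadingWord f v) : u = v := by
  by_contra h
  exact asymm_of (List.Shortlex (· < ·)) (hv.2 u hu.1 h) (hu.2 v hv.1 (Ne.symm h))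

namespace SkewPolynomialRelations

open FreeAlgebra

variable {k : Type*} [Field k] {n : ℕ} (S : SkewPolynomialRelations k n)

theorem relation_eq (p : DescPair n) : S.relation p
    = word k [p.1.1, p.1.2] - S.coeff p • word k [(S.rhs p).1, (S.rhs p).2] := by
  simp [relation, word]

theorem relation_mem_ideal (p : DescPair n) : S.relation p ∈ S.ideal :=
  TwoSidedIdeal.subset_span ⟨p, rfl⟩

theorem smul_mem_ideal (c : k) {f : FreeAlgebra k (Fin n)} (hf : f ∈ S.ideal) :
    c • f ∈ S.ideal := by
  rw [Algebra.smul_def]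
  exact S.ideal.mul_mem_left _ _ hf

theorem isLeadingWord_relation (p : DescPair n) :
    IsLeadingWord (S.relation p) [p.1.1, p.1.2] := by
  have hlt : List.Shortlex (· < ·) [(S.rhs p).1, (S.rhs p).2] [p.1.1, p.1.2] :=
    List.shortlex_append_cons_cons [] [] (S.rhs_fst_lt p) _ _
  have hne : [(S.rhs p).1, (S.rhs p).2] ≠ [p.1.1, p.1.2] := fun h => by
    rw [h] at hlt
    exact asymm_of (List.Shortlex (· < ·)) hlt hlt
  have hr : (wordBasis k (Fin n)).repr (S.relation p) = Finsupp.single [p.1.1, p.1.2] 1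
      - S.coeff p • Finsupp.single [(S.rhs p).1, (S.rhs p).2] 1 := by
    rw [relation_eq, map_sub, map_smul, ← wordBasis_apply, ← wordBasis_apply,
      Module.Basis.repr_self, Module.Basis.repr_self]
  refine ⟨?_, fun v hv hne' => ?_⟩
  · rw [mem_wordSupport_iff, hr, Finsupp.sub_apply, Finsupp.smul_apply, Finsupp.single_eq_same,
      Finsupp.single_eq_of_ne hne.symm]
    simp
  · by_cases h : v = [(S.rhs p).1, (S.rhs p).2]
    · rwa [h]
    · rw [mem_wordSupport_iff, hr, Finsupp.sub_apply, Finsupp.smul_apply,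
        Finsupp.single_eq_of_ne hne', Finsupp.single_eq_of_ne h] at hv
      simp at hv

/-! ### Normal forms give a Gröbner basis -/

theorem isGroebnerBasis_of_scalarNormalForm
    (N : ScalarNormalForm S.skewInvolution S.pairScalar) :
    IsGroebnerBasis S.relations S.ideal := by
  obtain ⟨F, h1, h2⟩ := SkewInvolution.exists_reduction N
  refine ⟨fun g hg => TwoSidedIdeal.subset_span hg, fun f hf hf0 => ?_⟩
  let Φ : FreeAlgebra k (Fin n) →ₗ[k] (List (Fin n) →₀ k) := (wordBasis k (Fin n)).constr k F
  have hΦ : ∀ l, Φ (word k l) = F l := fun l => by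
    rw [← wordBasis_apply]; exact Module.Basis.constr_basis _ _ _ _
  have hrel : ∀ p a b, Φ (a * S.relation p * b) = 0 := by
    intro p a b
    have ha : Φ ∘ₗ LinearMap.mulRight k (S.relation p * b) = 0 := by
      refine (wordBasis k (Fin n)).ext fun l => ?_
      have hb : Φ ∘ₗ LinearMap.mulLeft k (word k l * S.relation p) = 0 := by
        refine (wordBasis k (Fin n)).ext fun l' => ?_
        rw [LinearMap.comp_apply, LinearMap.mulLeft_apply, wordBasis_apply, relation_eq,
          mul_sub, sub_mul, mul_smul_comm, smul_mul_assoc, ← word_append, ← word_append,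
          ← word_append, ← word_append, map_sub, map_smul, hΦ, hΦ, LinearMap.zero_apply,
          sub_eq_zero]
        have hs := SkewInvolution.step_append (r := S.skewInvolution) (κ := S.pairScalar) p.2 l l'
        rw [Prod.mk.eta, S.pairScalar_desc,
          show S.skewInvolution.map p.1 = S.rhs p from S.pairMap_desc p] at hs
        simpa using h1 _ _ _ hs
      have := LinearMap.congr_fun hb b
      rw [LinearMap.comp_apply, LinearMap.mulLeft_apply, LinearMap.zero_apply, mul_assoc] at this
      rwa [LinearMap.comp_apply, LinearMap.mulRight_apply, wordBasis_apply]
    have := LinearMap.congr_fun ha a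
    rwa [LinearMap.comp_apply, LinearMap.mulRight_apply, LinearMap.zero_apply, ← mul_assoc] at this
  -- The arbitrary factors `a` and `b` make the statement stable under multiplication in the span
  -- induction.
  have hker : ∀ a b, Φ (a * f * b) = 0 := by
    refine TwoSidedIdeal.span_induction (p := fun f _ => ∀ a b, Φ (a * f * b) = 0)
      ?_ ?_ ?_ ?_ ?_ ?_ hf
    · rintro _ ⟨p, rfl⟩; exact hrel p
    · intro a b; simp
    · intro x y _ _ hx hy a b
      rw [mul_add, add_mul, map_add, hx, hy, add_zero]
    · intro x _ hx a b
      rw [mul_neg, neg_mul, map_neg, hx, neg_zero]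
    · intro c x _ hx a b
      rw [← mul_assoc]; exact hx _ _
    · intro c x _ hx a b
      rw [← mul_assoc, mul_assoc _ c b]; exact hx _ _
  obtain ⟨u, hu⟩ := exists_isLeadingWord hf0
  refine ⟨u, hu, ?_⟩
  -- A descent in `u` is the leading word of a relation. Without one, `u` is irreducible and the
  -- coefficient of `u` in `Φ f = 0` would be its nonzero coefficient in `f`.
  by_cases hd : ∃ b c, S.skewInvolution.Step S.pairScalar u b c
  · obtain ⟨_, _, p, q, x, y, hxy, rfl, -, -⟩ := hd
    exact ⟨_, ⟨⟨(x, y), hxy⟩, rfl⟩, _, S.isLeadingWord_relation _, p, q, by simp⟩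
  · exfalso
    push Not at hd
    have h0 := hker 1 1
    rw [one_mul, mul_one, Module.Basis.constr_apply] at h0
    have h0 := DFunLike.congr_fun h0 u
    rw [Finsupp.sum_apply, Finsupp.sum, Finset.sum_eq_single u] at h0
    · rw [h2 u hd, Finsupp.smul_apply, Finsupp.single_eq_same, smul_eq_mul, mul_one] at h0
      exact mem_wordSupport_iff.1 hu.1 h0
    · intro v hv hvu
      rw [Finsupp.smul_apply, SkewInvolution.reduction_apply_eq_zero h1 h2 u v, smul_zero]
      exact hu.2 v (mem_wordSupport_iff.2 (Finsupp.mem_support_iff.1 hv)) hvu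
    · intro hu'
      rw [Finsupp.notMem_support_iff.1 hu', zero_smul]; rfl

/-! ### A Gröbner basis gives normal forms -/

/-- The list of the letters of a word of length three. -/
def _root_.Triple.toList (w : Triple n) : List (Fin n) := [w.1, w.2.1, w.2.2]

theorem _root_.Triple.toList_injective : Function.Injective (Triple.toList (n := n)) := by
  rintro ⟨x, y, z⟩ ⟨x', y', z'⟩ h
  simpa [Triple.toList] using h

theorem word_sub_pairMap_mem (q : Fin n × Fin n) :
    word k [q.1, q.2] - S.pairScalar q • word k [(S.pairMap q).1, (S.pairMap q).2] ∈ S.ideal := by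
  refine S.pair_cases (P := fun q => word k [q.1, q.2]
    - S.pairScalar q • word k [(S.pairMap q).1, (S.pairMap q).2] ∈ S.ideal) (fun p => ?_)
    (fun p => ?_) (fun x => ?_) q
  · rw [S.pairMap_desc, S.pairScalar_desc, ← relation_eq]
    exact S.relation_mem_ideal p
  · have := S.smul_mem_ideal (-(S.coeff p)⁻¹) (S.relation_mem_ideal p)
    rw [relation_eq, smul_sub, smul_smul, neg_mul, inv_mul_cancel₀ (S.coeff_ne_zero p)] at this
    rw [S.pairMap_asc, S.pairScalar_asc]
    convert this using 1
    module
  · rw [S.pairMap_diag, S.pairScalar_diag, one_smul, sub_self]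
    exact S.ideal.zero_mem

theorem word_sub_left_mem (w : Triple n) : word k w.toList
    - S.pairScalar (w.1, w.2.1) • word k (S.skewInvolution.left w).toList ∈ S.ideal := by
  have := S.ideal.mul_mem_right _ (word k [w.2.2]) (S.word_sub_pairMap_mem (w.1, w.2.1))
  rwa [sub_mul, smul_mul_assoc, ← word_append, ← word_append] at this

theorem word_sub_right_mem (w : Triple n) : word k w.toList
    - S.pairScalar w.2 • word k (S.skewInvolution.right w).toList ∈ S.ideal := by
  have := S.ideal.mul_mem_left (word k [w.1]) _ (S.word_sub_pairMap_mem w.2)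
  rwa [mul_sub, mul_smul_comm, ← word_append, ← word_append] at this

theorem sub_smul_mem_trans {f g h : FreeAlgebra k (Fin n)} {c d : k}
    (h1 : f - c • g ∈ S.ideal) (h2 : g - d • h ∈ S.ideal) : f - (c * d) • h ∈ S.ideal := by
  have := S.ideal.add_mem h1 (S.smul_mem_ideal c h2)
  rwa [smul_sub, smul_smul, sub_add_sub_cancel] at this

theorem exists_normal_sub_mem (w : Triple n) : ∃ (u : Triple n) (c : k), u.IsNormal ∧ c ≠ 0 ∧
    word k w.toList - c • word k u.toList ∈ S.ideal := by
  refine S.skewInvolution.triple_induction (P := fun w => ∃ (u : Triple n) (c : k),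
    u.IsNormal ∧ c ≠ 0 ∧ word k w.toList - c • word k u.toList ∈ S.ideal)
    (fun w hw => ⟨w, 1, hw, one_ne_zero, ?_⟩) (fun w _ => ?_) (fun w _ => ?_) w
  · rw [one_smul, sub_self]
    exact S.ideal.zero_mem
  · rintro ⟨u, c, hu, hc, hm⟩
    exact ⟨u, _, hu, mul_ne_zero (S.pairScalar_ne_zero _) hc,
      S.sub_smul_mem_trans (S.word_sub_left_mem w) hm⟩
  · rintro ⟨u, c, hu, hc, hm⟩
    exact ⟨u, _, hu, mul_ne_zero (S.pairScalar_ne_zero _) hc,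
      S.sub_smul_mem_trans (S.word_sub_right_mem w) hm⟩

theorem _root_.Triple.IsNormal.not_infix {u : Triple n} (hu : u.IsNormal) {x y : Fin n}
    (h : y < x) : ¬ [x, y] <:+: u.toList := by
  intro hi
  have hs : u.toList.Pairwise (· ≤ ·) := by
    simp [Triple.toList, hu.1, hu.2, hu.1.trans hu.2]
  have := hs.sublist hi.sublist
  simp at this
  exact this.not_gt h

/-- A nonzero difference would have a normal leading word, which contains no descent and so no
leading word of a relation. -/
theorem normal_unique (hG : IsGroebnerBasis S.relations S.ideal) {u v : Triple n} {c d : k}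
    (hu : u.IsNormal) (hv : v.IsNormal) (hc : c ≠ 0)
    (h : c • word k u.toList - d • word k v.toList ∈ S.ideal) : u = v ∧ c = d := by
  set f := c • word k u.toList - d • word k v.toList with hf
  have hr : (wordBasis k (Fin n)).repr f = Finsupp.single u.toList c
      - Finsupp.single v.toList d := by
    rw [hf, map_sub, map_smul, map_smul, ← wordBasis_apply, ← wordBasis_apply,
      Module.Basis.repr_self, Module.Basis.repr_self]
    simp
  by_cases hf0 : f = 0
  · rw [hf0, map_zero, eq_comm, sub_eq_zero] at hr
    rcases (Finsupp.single_eq_single_iff _ _ _ _).1 hr with h | h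
    · exact ⟨Triple.toList_injective h.1, h.2⟩
    · exact absurd h.1 hc
  · exfalso
    obtain ⟨t, ht, g, ⟨p, rfl⟩, s, hs, hst⟩ := hG.2 f h hf0
    rw [hs.eq (S.isLeadingWord_relation p)] at hst
    have ht' := mem_wordSupport_iff.1 ht.1
    rw [hr, Finsupp.sub_apply] at ht'
    by_cases h1 : t = u.toList
    · exact hu.not_infix p.2 (h1 ▸ hst)
    · by_cases h2 : t = v.toList
      · exact hv.not_infix p.2 (h2 ▸ hst)
      · rw [Finsupp.single_eq_of_ne h1, Finsupp.single_eq_of_ne h2, sub_zero] at ht'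
        exact ht' rfl

theorem nonempty_scalarNormalForm_of_isGroebnerBasis
    (hG : IsGroebnerBasis S.relations S.ideal) :
    Nonempty (ScalarNormalForm S.skewInvolution S.pairScalar) := by
  choose nf sc hn hsc hm using S.exists_normal_sub_mem
  have key : ∀ (w u : Triple n) (c : k), u.IsNormal →
      word k w.toList - c • word k u.toList ∈ S.ideal → nf w = u ∧ sc w = c := by
    intro w u c hu h
    refine S.normal_unique hG (hn w) hu (hsc w) ?_
    have := S.ideal.sub_mem h (hm w)
    rwa [sub_sub_sub_cancel_left] at this
  have hself : ∀ w : Triple n, w.IsNormal → nf w = w ∧ sc w = 1 := fun w hw =>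
    key w w 1 hw (by rw [one_smul, sub_self]; exact S.ideal.zero_mem)
  have hl := fun w => key w _ _ (hn _) (S.sub_smul_mem_trans (S.word_sub_left_mem w) (hm _))
  have hr := fun w => key w _ _ (hn _) (S.sub_smul_mem_trans (S.word_sub_right_mem w) (hm _))
  exact ⟨{
    nf := nf
    nf_left := fun w => (hl w).1.symm
    nf_right := fun w => (hr w).1.symm
    isNormal_nf := hn
    nf_eq := fun w hw => (hself w hw).1
    scalar := sc
    scalar_ne_zero := hsc
    scalar_eq_one := fun w hw => (hself w hw).2
    scalar_left := fun w => (hl w).2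
    scalar_right := fun w => (hr w).2 }⟩

end SkewPolynomialRelations

theorem mainTheorem9 {k : Type*} [Field k] {n : ℕ} {V : Type*} [AddCommGroup V] [Module k V]
    (x : Module.Basis (Fin n) k V) (S : SkewPolynomialRelations k n) :
    IsYangBaxterSolution (S.automorphism x) ↔ IsGroebnerBasis S.relations S.ideal := by
  constructor
  · intro h
    obtain ⟨N⟩ := S.nonempty_scalarNormalForm_of_termBraid
      (S.termBraid_of_isYangBaxterSolution x h)
    exact S.isGroebnerBasis_of_scalarNormalForm N
  · intro h
    obtain ⟨N⟩ := S.nonempty_scalarNormalForm_of_isGroebnerBasis h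
    exact S.isYangBaxterSolution_of_scalarNormalForm x N
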